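/- Let $d\ge 3$ be an integer, $\|\cdot\|$ a norm on $\mathbb R^d$, $p\in[1,\tfrac d2)$ and $q>\frac{dp}{d-p}$. For finite Borel measures $\mu,\nu$ on $\mathbb R^d$ of equal mass let $$\rho_p(\mu,\nu)=\inf_{\xi}\Bigl(\int_{\mathbb R^d\times\mathbb R^d}\|x-y\|^p\,\mathrm d\xi(x,y)\Bigr)^{1/p},$$ the infimum being over all measures $\xi$ on $\mathbb R^d\times\mathbb R^d$ with first marginal $\mu$ and second marginal $\nu$. For a Borel probability measure $\mu$ on $\mathbb R^d$ and an integer $N\ge 1$ let $$V^{\mathrm{rand}}_{N,p}(\mu)=\mathbb E\bigl[\rho_p(\mu,\hat\mu_N)^p\bigr]^{1/p},\qquad \hat\mu_N=\frac1N\sum_{j=1}^N\delta_{X_j},$$ where $X_1,\dots,X_N$ are independent with law $\mu$. (a) There is a constant $\kappa\in(0,\infty)$, depending only on $d$, $\|\cdot\|$, $p$ and $q$, such that for every Borel probability measure $\mu$ on $\mathbb R^d$ and every integer $N\ge1$ $$V^{\mathrm{rand}}_{N,p}(\mu)\le \kappa\Bigl[\int_{\mathbb R^d}\|x\|^q\,\mathrm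 d\mu(x)\Bigr]^{1/q}N^{-1/d}$$ (the right-hand side is $+\infty$ if the integral diverges). (b) If $\|\cdot\|=\|\cdot\|_{\max}$ is the maximum norm and moreover $q>2p$, then the inequality in (a) holds, for every $\mu$ and every $N\ge1$, with $$\kappa=\kappa_p^{\mathrm{cube}}\left[\frac{2^{p-1}\,2^{q/2}\,\mathfrak d^p}{1-2^{p-q/2}}+\frac{2^{p+q(1-p/d)}\,(\kappa_p^{\mathrm{cube}})^p}{1-2^{-q(1-p/d)+p}}\right]^{1/p},$$ where $$\kappa_p^{\mathrm{cube}}=\mathfrak d\;2^{\frac{d-2}{2p}}\left[\frac1{1-2^{p-d/2}}+\frac1{1-2^{-p}}\right]^{1/p}$$ and $\mathfrak d=\sup_{x,y\in[0,1)^d}\|x-y\|_{\max}$ is the diameter of the unit cube. -/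

import Mathlib

open MeasureTheory
open scoped ENNReal

noncomputable section

/-- The transports from `μ` to `ν`: all measures on `ℝ^d × ℝ^d` with first marginal `μ` and
second marginal `ν` (for finite `μ` such a measure is automatically finite). -/
def transports {d : ℕ} (μ ν : Measure (Fin d → ℝ)) :
    Set (Measure ((Fin d → ℝ) × (Fin d → ℝ))) :=
  {ξ | ξ.map Prod.fst = μ ∧ ξ.map Prod.snd = ν}

/-- The `p`-th Wasserstein distance on `ℝ^d`, with respect to the norm `nrm`, as an extended
nonnegative number. -/
def wasserstein {d : ℕ} (nrm : Seminorm ℝ (Fin d → ℝ)) (p : ℝ) (μ ν : Measure (Fin d → ℝ)) :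
    ℝ≥0∞ :=
  ⨅ ξ ∈ transports μ ν, (∫⁻ z, ENNReal.ofReal (nrm (z.1 - z.2) ^ p) ∂ξ) ^ (1 / p)

/-- The empirical measure `(1/N) ∑ j, δ_{x j}` of the points `x 0, …, x (N - 1)`. -/
def empiricalMeasure {d N : ℕ} (x : Fin N → Fin d → ℝ) : Measure (Fin d → ℝ) :=
  (N : ℝ≥0∞)⁻¹ • ∑ j, Measure.dirac (x j)

/-- The random quantization error `(E [ρ_p(μ, μ̂_N) ^ p]) ^ (1/p)`, where `μ̂_N` is the empirical
measure of `N` independent samples of `μ`; the joint law of the samples is the product measure. -/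
def randError {d : ℕ} (nrm : Seminorm ℝ (Fin d → ℝ)) (N : ℕ) (p : ℝ)
    (μ : Measure (Fin d → ℝ)) : ℝ≥0∞ :=
  (∫⁻ x : Fin N → Fin d → ℝ, wasserstein nrm p μ (empiricalMeasure x) ^ p
    ∂(Measure.pi fun _ : Fin N => μ)) ^ (1 / p)

/-- The absolute moment `∫ ‖x‖^q dμ(x)`, as an extended nonnegative number. -/
def absMoment {d : ℕ} (nrm : Seminorm ℝ (Fin d → ℝ)) (q : ℝ) (μ : Measure (Fin d → ℝ)) : ℝ≥0∞ :=
  ∫⁻ x, ENNReal.ofReal (nrm x ^ q) ∂μ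

/-- The maximum norm on `ℝ^d`. -/
def maxNorm (d : ℕ) : Seminorm ℝ (Fin d → ℝ) := normSeminorm ℝ (Fin d → ℝ)

/-- The diameter of the cube `[0,1)^d` with respect to the norm `nrm`. -/
def cubeDiam {d : ℕ} (nrm : Seminorm ℝ (Fin d → ℝ)) : ℝ :=
  sSup {r | ∃ x y : Fin d → ℝ, (∀ i, x i ∈ Set.Ico (0 : ℝ) 1) ∧ (∀ i, y i ∈ Set.Ico (0 : ℝ) 1) ∧
    r = nrm (x - y)}

/-- The constant `κ_p^cube`. -/
def kappaCube {d : ℕ} (nrm : Seminorm ℝ (Fin d → ℝ)) (p : ℝ) : ℝ :=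
  cubeDiam nrm * (2 : ℝ) ^ (((d : ℝ) - 2) / (2 * p)) *
    (1 / (1 - (2 : ℝ) ^ (p - (d : ℝ) / 2)) + 1 / (1 - (2 : ℝ) ^ (-p))) ^ (1 / p)

/-- The explicit constant `κ_{p,q}^Pierce`. -/
def kappaPierce {d : ℕ} (nrm : Seminorm ℝ (Fin d → ℝ)) (p q : ℝ) : ℝ :=
  kappaCube nrm p *
    ((2 : ℝ) ^ (p - 1) * (2 : ℝ) ^ (q / 2) * cubeDiam nrm ^ p / (1 - (2 : ℝ) ^ (p - q / 2)) +
      (2 : ℝ) ^ (p + q * (1 - p / d)) * kappaCube nrm p ^ p /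
        (1 - (2 : ℝ) ^ (-q * (1 - p / d) + p))) ^ (1 / p)

end

/-! Work in the maximum norm and fix a scale `s` with `q`-th moment at most `s ^ q`. Split space
into dyadic rings, the `n`-th lying in the ball of radius `s * 2 ^ n`; Markov's inequality makes
their masses decay like `2 ^ (-n q)`. Cut the cube around each ring into `2 ^ (k d)` equal cells,
for every level `k`.

The coupling works from fine to coarse (`exists_transport_le_cellExcess`): match as much mass as
possible inside the cells of level `K`, then match the remainder inside the cells of level `K - 1`,
and so on. What is moved at level `k` is the excess of `μ` over the empirical measure on the cells
of level `k + 1`. At the end only the imbalance between rings is left, and it is coupled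
arbitrarily.

On a ring of mass `m` the expected excess at level `k` is at most `m`, and by the variance of the
empirical mean and Cauchy–Schwarz over the cells at most half the square root of `2 ^ (k d) * m /
N`. Weighted by the cell costs, these bounds give geometric series on the two sides of `2 ^ k ≈ (m
N) ^ (1/d)` (`sum_dyadic_min_le`); the coarse side is controlled because `p < d/2`. The ring
contributes a constant times `(s 2 ^ n) ^ p * N ^ (-p/d) * m ^ (1 - p/d)`, which is summable over
`n` because `q (1 - p/d) > p`, a rewriting of `q > dp/(d-p)`.

The imbalance between rings is handled in two ways: interpolating the square-root bound with the
trivial one covers all admissible `q`; the square-root bound alone needs `q > 2p` and gives the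
explicit constant. Letting `K` tend to infinity and `s` decrease to the moment norm yields the
maximum-norm case; equivalence of norms gives the rest of (a). -/

/-! ### Couplings along nested partitions. -/

section PartialTransport

variable {X ι : Type*} [MeasurableSpace X]

/-- Reweighting a measure on the fibers of `L`. -/
noncomputable def fiberReweight (μ : Measure X) (L : X → ι) (w : ι → ℝ≥0∞) : Measure X :=
  Measure.sum fun c => w c • μ.restrict (L ⁻¹' {c})

theorem fiberReweight_apply (μ : Measure X) (L : X → ι) (w : ι → ℝ≥0∞) {A : Set X}
    (hA : MeasurableSet A) : fiberReweight μ L w A = ∑' c, w c * μ (A ∩ L ⁻¹' {c}) := by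
  simp [fiberReweight, Measure.sum_apply _ hA, Measure.restrict_apply hA]

variable [MeasurableSpace ι] [MeasurableSingletonClass ι]

theorem fiberReweight_fiber (μ : Measure X) {L : X → ι} (hL : Measurable L) (w : ι → ℝ≥0∞)
    (c : ι) : fiberReweight μ L w (L ⁻¹' {c}) = w c * μ (L ⁻¹' {c}) := by
  rw [fiberReweight_apply μ L w (hL (measurableSet_singleton c)), tsum_eq_single c]
  · rw [Set.inter_self]
  · intro b hb
    have : L ⁻¹' {c} ∩ L ⁻¹' {b} = ∅ := by
      rw [← Set.preimage_inter, Set.singleton_inter_eq_empty.2 (by simpa using hb.symm),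
        Set.preimage_empty]
    rw [this, measure_empty, mul_zero]

variable [Countable ι]

theorem measure_eq_tsum_inter_fiber (μ : Measure X) {L : X → ι} (hL : Measurable L)
    {A : Set X} (hA : MeasurableSet A) : μ A = ∑' c, μ (A ∩ L ⁻¹' {c}) := by
  have hm : ∀ c, MeasurableSet (A ∩ L ⁻¹' {c}) := fun c =>
    hA.inter (hL (measurableSet_singleton c))
  rw [← measure_iUnion _ hm]
  · congr 1
    ext x
    simp
  · intro c c' hcc
    refine Set.disjoint_left.2 ?_
    rintro x ⟨_, hx⟩ ⟨_, hx'⟩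
    exact hcc (hx.symm.trans hx')

theorem fiberReweight_add_compl (μ : Measure X) {L : X → ι} (hL : Measurable L)
    {w : ι → ℝ≥0∞} (hw : ∀ c, w c ≤ 1) :
    fiberReweight μ L w + fiberReweight μ L (fun c => 1 - w c) = μ := by
  ext A hA
  rw [Measure.add_apply, fiberReweight_apply _ _ _ hA, fiberReweight_apply _ _ _ hA,
    ← ENNReal.tsum_add, measure_eq_tsum_inter_fiber μ hL hA]
  refine tsum_congr fun c => ?_
  rw [← add_mul, add_tsub_cancel_of_le (hw c), one_mul]

theorem one_sub_inv_max_mul_self {a b : ℝ≥0∞} (ha : a ≠ ∞) (hb : b ≠ ∞) :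
    (1 - (max a b)⁻¹ * b) * a = a - b := by
  have hmax : max a b ≠ ∞ := by simp [ha, hb]
  rcases eq_or_ne a 0 with rfl | h0
  · simp
  · have hm0 : max a b ≠ 0 := fun h => h0 (le_antisymm (h ▸ le_max_left a b) bot_le)
    rw [ENNReal.sub_mul (fun _ _ => ha), one_mul]
    rcases le_total a b with h | h
    · rw [max_eq_right h] at hm0 ⊢
      rw [ENNReal.inv_mul_cancel hm0 hb, one_mul, tsub_self, tsub_eq_zero_of_le h]
    · rw [max_eq_left h, mul_right_comm, ENNReal.inv_mul_cancel h0 ha, one_mul]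

theorem inv_max_mul_le_one (a b : ℝ≥0∞) : (max a b)⁻¹ * b ≤ 1 := by
  calc (max a b)⁻¹ * b ≤ (max a b)⁻¹ * max a b := by gcongr; exact le_max_right a b
    _ ≤ 1 := ENNReal.inv_mul_le_one _

/-- Two finite measures can be matched, as far as their masses allow, inside the cells of a countable
measurable partition. -/
theorem exists_partial_transport (μ ν : Measure X) [IsFiniteMeasure μ] [IsFiniteMeasure ν]
    {L : X → ι} (hL : Measurable L) :
    ∃ (ξ : Measure (X × X)) (μ' ν' : Measure X),
      ξ.map Prod.fst + μ' = μ ∧ ξ.map Prod.snd + ν' = ν ∧ (∀ᵐ z ∂ξ, L z.1 = L z.2) ∧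
      (∀ c, μ' (L ⁻¹' {c}) = μ (L ⁻¹' {c}) - ν (L ⁻¹' {c})) ∧
      (∀ c, ν' (L ⁻¹' {c}) = ν (L ⁻¹' {c}) - μ (L ⁻¹' {c})) := by
  set C : ι → Set X := fun c => L ⁻¹' {c} with hC
  have hCm : ∀ c, MeasurableSet (C c) := fun c => hL (measurableSet_singleton c)
  set v : ι → ℝ≥0∞ := fun c => (max (μ (C c)) (ν (C c)))⁻¹ * ν (C c) with hv
  set w : ι → ℝ≥0∞ := fun c => (max (ν (C c)) (μ (C c)))⁻¹ * μ (C c) with hw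
  -- With cell masses `a`, `b`, dividing the product coupling by `max a b` leaves total mass `min a
  -- b`, so the smaller measure is used up on the cell. If both vanish, the infinite weight
  -- multiplies the zero measure.
  refine ⟨Measure.sum fun c => (max (μ (C c)) (ν (C c)))⁻¹ •
      (μ.restrict (C c)).prod (ν.restrict (C c)),
    fiberReweight μ L (fun c => 1 - v c), fiberReweight ν L (fun c => 1 - w c), ?_, ?_, ?_, ?_, ?_⟩
  · have : (Measure.sum fun c => (max (μ (C c)) (ν (C c)))⁻¹ •
        (μ.restrict (C c)).prod (ν.restrict (C c))).map Prod.fst = fiberReweight μ L v := by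
      rw [Measure.map_sum measurable_fst.aemeasurable, fiberReweight]
      congr 1
      ext1 c
      rw [Measure.map_smul, Measure.map_fst_prod, Measure.restrict_apply_univ, smul_smul]
    rw [this, fiberReweight_add_compl μ hL fun c => inv_max_mul_le_one _ _]
  · have : (Measure.sum fun c => (max (μ (C c)) (ν (C c)))⁻¹ •
        (μ.restrict (C c)).prod (ν.restrict (C c))).map Prod.snd = fiberReweight ν L w := by
      rw [Measure.map_sum measurable_snd.aemeasurable, fiberReweight]
      congr 1
      ext1 c
      rw [Measure.map_smul, Measure.map_snd_prod, Measure.restrict_apply_univ, smul_smul,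
        max_comm]
    rw [this, fiberReweight_add_compl ν hL fun c => inv_max_mul_le_one _ _]
  · rw [Measure.ae_sum_iff]
    intro c
    refine Measure.ae_smul_measure ?_ _
    rw [Measure.prod_restrict]
    filter_upwards [ae_restrict_mem ((hCm c).prod (hCm c))] with z hz
    exact (show L z.1 = c from hz.1).trans (show L z.2 = c from hz.2).symm
  · intro c
    rw [fiberReweight_fiber μ hL]
    exact one_sub_inv_max_mul_self (measure_ne_top _ _) (measure_ne_top _ _)
  · intro c
    rw [fiberReweight_fiber ν hL]
    exact one_sub_inv_max_mul_self (measure_ne_top _ _) (measure_ne_top _ _)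

theorem exists_transport_of_eq_mass (μ ν : Measure X) [IsFiniteMeasure μ] [IsFiniteMeasure ν]
    (h : μ Set.univ = ν Set.univ) :
    ∃ ξ : Measure (X × X), ξ.map Prod.fst = μ ∧ ξ.map Prod.snd = ν := by
  rcases eq_or_ne (μ Set.univ) 0 with h0 | h0
  · refine ⟨0, ?_, ?_⟩
    · simpa using (Measure.measure_univ_eq_zero.1 h0).symm
    · simpa using (Measure.measure_univ_eq_zero.1 (h ▸ h0)).symm
  · refine ⟨(μ Set.univ)⁻¹ • μ.prod ν, ?_, ?_⟩
    · rw [Measure.map_smul, Measure.map_fst_prod, smul_smul, ← h,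
        ENNReal.inv_mul_cancel h0 (measure_ne_top _ _), one_smul]
    · rw [Measure.map_smul, Measure.map_snd_prod, smul_smul,
        ENNReal.inv_mul_cancel h0 (measure_ne_top _ _), one_smul]

theorem lintegral_comp_countable (μ : Measure X) {L : X → ι} (hL : Measurable L)
    (F : ι → ℝ≥0∞) : ∫⁻ x, F (L x) ∂μ = ∑' c, F c * μ (L ⁻¹' {c}) := by
  rw [← lintegral_map (measurable_of_countable F) hL, lintegral_countable']
  refine tsum_congr fun c => ?_
  rw [Measure.map_apply hL (measurableSet_singleton c)]

/-- A coupling that does not cross the boundary of `A` takes the same mass from both measures on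
`A`, and this cancels in the differences. Hence matching at a fine level does not change the excess
on coarser cells. -/
theorem measure_sub_eq_of_partial_transport {ξ : Measure (X × X)} {μ ν μ' ν' : Measure X}
    [IsFiniteMeasure μ] (h1 : ξ.map Prod.fst + μ' = μ) (h2 : ξ.map Prod.snd + ν' = ν)
    {A : Set X} (hA : MeasurableSet A) (hξ : ∀ᵐ z ∂ξ, z.1 ∈ A ↔ z.2 ∈ A) :
    μ' A - ν' A = μ A - ν A ∧ ν' A - μ' A = ν A - μ A := by
  have e : ξ.map Prod.fst A = ξ.map Prod.snd A := by
    rw [Measure.map_apply measurable_fst hA, Measure.map_apply measurable_snd hA]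
    refine measure_congr ?_
    filter_upwards [hξ] with z hz
    exact propext hz
  have hf : ξ.map Prod.fst A ≠ ∞ := by
    refine ne_top_of_le_ne_top (measure_ne_top μ A) ?_
    rw [← h1, Measure.add_apply]
    exact le_self_add
  rw [← h1, ← h2, Measure.add_apply, Measure.add_apply, ← e]
  constructor <;> rw [ENNReal.add_sub_add_eq_sub_left hf]

/-- The mass by which `μ` exceeds `ν`, summed over the cells of level `k` in the `n`-th ring. -/
noncomputable def cellExcess (r : X → ℕ) (t : ℕ → X → ι) (μ ν : Measure X) (k n : ℕ) : ℝ≥0∞ :=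
  ∑' f, (μ ((fun x => (r x, t k x)) ⁻¹' {(n, f)}) - ν ((fun x => (r x, t k x)) ⁻¹' {(n, f)}))

/-- Coupling along nested partitions: the mass in excess at level `k + 1` is transported inside the
cells of level `k`, and the excess mass of a ring is transported arbitrarily. -/
theorem exists_transport_le_cellExcess {r : X → ℕ} {t : ℕ → X → ι} (hr : Measurable r)
    (ht : ∀ k, Measurable (t k)) (h0 : ∀ x y, r x = r y → t 0 x = t 0 y)
    (hnest : ∀ k x y, r x = r y → t (k + 1) x = t (k + 1) y → t k x = t k y)
    {c : X → X → ℝ≥0∞} {D : ℕ → ℕ → ℝ≥0∞} {a : ℕ → ℝ≥0∞}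
    (hD : ∀ k x y, r x = r y → t k x = t k y → c x y ≤ D k (r x))
    (ha : ∀ x y, c x y ≤ a (r x) + a (r y)) (K : ℕ) :
    ∀ (μ ν : Measure X) [IsFiniteMeasure μ] [IsFiniteMeasure ν], μ Set.univ = ν Set.univ →
      ∃ ξ : Measure (X × X), ξ.map Prod.fst = μ ∧ ξ.map Prod.snd = ν ∧
        ∫⁻ z, c z.1 z.2 ∂ξ ≤ ∑' n, D K n * μ (r ⁻¹' {n}) +
          ∑ k ∈ Finset.range K, ∑' n, D k n * cellExcess r t μ ν (k + 1) n +
          ∑' n, a n * ((μ (r ⁻¹' {n}) - ν (r ⁻¹' {n})) + (ν (r ⁻¹' {n}) - μ (r ⁻¹' {n}))) := by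
  have key : ∀ (b : ℕ → ℝ≥0∞) (μ μ' : Measure X) (ξ : Measure (X × X)), ξ.map Prod.fst + μ' = μ →
      (∀ᵐ z ∂ξ, c z.1 z.2 ≤ b (r z.1)) → ∫⁻ z, c z.1 z.2 ∂ξ ≤ ∑' n, b n * μ (r ⁻¹' {n}) := by
    intro b μ μ' ξ h1 hb
    calc ∫⁻ z, c z.1 z.2 ∂ξ ≤ ∫⁻ z, b (r z.1) ∂ξ := lintegral_mono_ae hb
      _ = ∫⁻ x, b (r x) ∂(ξ.map Prod.fst) :=
        (lintegral_map ((measurable_of_countable b).comp hr) measurable_fst).symm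
      _ ≤ ∫⁻ x, b (r x) ∂μ := by
        rw [← h1, lintegral_add_measure]
        exact le_self_add
      _ = _ := lintegral_comp_countable μ hr b
  have fin1 : ∀ (μ₁ μ' μ : Measure X) [IsFiniteMeasure μ], μ₁ + μ' = μ → IsFiniteMeasure μ' := by
    intro μ₁ μ' μ _ h
    exact isFiniteMeasure_of_le μ (h ▸ Measure.le_add_left le_rfl)
  have mass : ∀ (ξ : Measure (X × X)) (μ ν μ' ν' : Measure X) [IsFiniteMeasure μ],
      ξ.map Prod.fst + μ' = μ → ξ.map Prod.snd + ν' = ν → μ Set.univ = ν Set.univ →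
      μ' Set.univ = ν' Set.univ := by
    intro ξ μ ν μ' ν' _ h1 h2 h
    have e : ξ.map Prod.fst Set.univ = ξ.map Prod.snd Set.univ := by
      rw [Measure.map_apply measurable_fst .univ, Measure.map_apply measurable_snd .univ,
        Set.preimage_univ, Set.preimage_univ]
    have hf : ξ.map Prod.fst Set.univ ≠ ∞ := by
      refine ne_top_of_le_ne_top (measure_ne_top μ Set.univ) ?_
      rw [← h1, Measure.add_apply]
      exact le_self_add
    rw [← h1, ← h2, Measure.add_apply, Measure.add_apply, ← e] at h
    exact (ENNReal.add_right_inj hf).1 h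
  induction K with
  | zero =>
    intro μ ν _ _ hm
    obtain ⟨ξ, μ', ν', h1, h2, h3, h4, h5⟩ := exists_partial_transport μ ν hr
    have := fin1 _ _ _ h1
    have := fin1 _ _ _ h2
    -- Any coupling of the remainders will do: `ha` bounds the cost by a sum of functions of the two
    -- endpoints, so only the marginals enter.
    obtain ⟨ξ', h1', h2'⟩ := exists_transport_of_eq_mass μ' ν' (mass ξ μ ν μ' ν' h1 h2 hm)
    refine ⟨ξ + ξ', ?_, ?_, ?_⟩
    · rw [Measure.map_add _ _ measurable_fst, h1', h1]
    · rw [Measure.map_add _ _ measurable_snd, h2', h2]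
    · rw [lintegral_add_measure, Finset.range_zero, Finset.sum_empty, add_zero]
      refine add_le_add ?_ ?_
      · refine key _ _ _ _ h1 ?_
        filter_upwards [h3] with z hz
        exact hD 0 _ _ hz (h0 _ _ hz)
      · have ma : Measurable fun x => a (r x) := (measurable_of_countable a).comp hr
        calc ∫⁻ z, c z.1 z.2 ∂ξ' ≤ ∫⁻ z, (a (r z.1) + a (r z.2)) ∂ξ' :=
              lintegral_mono fun z => ha z.1 z.2
          _ = ∫⁻ z, a (r z.1) ∂ξ' + ∫⁻ z, a (r z.2) ∂ξ' :=
            lintegral_add_left (ma.comp measurable_fst) _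
          _ = ∫⁻ x, a (r x) ∂μ' + ∫⁻ x, a (r x) ∂ν' := by
            rw [← lintegral_map ma measurable_fst, ← lintegral_map ma measurable_snd, h1', h2']
          _ = ∑' n, a n * ((μ (r ⁻¹' {n}) - ν (r ⁻¹' {n})) +
                (ν (r ⁻¹' {n}) - μ (r ⁻¹' {n}))) := by
            rw [lintegral_comp_countable _ hr, lintegral_comp_countable _ hr, ← ENNReal.tsum_add]
            refine tsum_congr fun n => ?_
            rw [h4, h5, mul_add]
  | succ K ih =>
    intro μ ν _ _ hm
    have hL : ∀ k, Measurable fun x => (r x, t k x) := fun k => hr.prodMk (ht k)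
    -- The finest level is matched first and the induction hypothesis is applied to the remainders,
    -- which is why the measures are quantified after `K`.
    obtain ⟨ξ, μ', ν', h1, h2, h3, h4, h5⟩ := exists_partial_transport μ ν (hL (K + 1))
    have := fin1 _ _ _ h1
    have := fin1 _ _ _ h2
    obtain ⟨ξ', h1', h2', h3'⟩ := ih μ' ν' (mass ξ μ ν μ' ν' h1 h2 hm)
    have nest : ∀ j, j ≤ K + 1 → ∀ x y, (r x, t (K + 1) x) = (r y, t (K + 1) y) →
        (r x, t j x) = (r y, t j y) := by
      intro j hj
      induction hj using Nat.decreasingInduction with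
      | self => exact fun x y h => h
      | of_succ k _ ih =>
        intro x y h
        have := Prod.mk.inj (ih x y h)
        exact Prod.ext this.1 (hnest k x y this.1 this.2)
    have exc : ∀ k ≤ K + 1, ∀ n, cellExcess r t μ' ν' k n = cellExcess r t μ ν k n := by
      intro k hk n
      refine tsum_congr fun f => ?_
      refine (measure_sub_eq_of_partial_transport h1 h2
        (hL k (measurableSet_singleton _)) ?_).1
      filter_upwards [h3] with z hz
      have := nest k hk _ _ hz
      simp only [Set.mem_preimage, Set.mem_singleton_iff] at this ⊢
      rw [this]
    have rng : ∀ n, μ' (r ⁻¹' {n}) - ν' (r ⁻¹' {n}) = μ (r ⁻¹' {n}) - ν (r ⁻¹' {n}) ∧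
        ν' (r ⁻¹' {n}) - μ' (r ⁻¹' {n}) = ν (r ⁻¹' {n}) - μ (r ⁻¹' {n}) := by
      intro n
      refine measure_sub_eq_of_partial_transport h1 h2 (hr (measurableSet_singleton _)) ?_
      filter_upwards [h3] with z hz
      have := (Prod.mk.inj hz).1
      simp only [Set.mem_preimage, Set.mem_singleton_iff, this]
    -- This turns the leading term `D K` of the induction hypothesis into the summand `k = K` of the
    -- new sum.
    have left : ∀ n, μ' (r ⁻¹' {n}) = cellExcess r t μ ν (K + 1) n := by
      intro n
      rw [measure_eq_tsum_inter_fiber μ' (ht (K + 1)) (hr (measurableSet_singleton n))]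
      refine tsum_congr fun f => ?_
      rw [← h4]
      congr 1
      ext x
      simp
    refine ⟨ξ + ξ', ?_, ?_, ?_⟩
    · rw [Measure.map_add _ _ measurable_fst, h1', h1]
    · rw [Measure.map_add _ _ measurable_snd, h2', h2]
    · rw [lintegral_add_measure]
      have A : ∫⁻ z, c z.1 z.2 ∂ξ ≤ ∑' n, D (K + 1) n * μ (r ⁻¹' {n}) := by
        refine key _ _ _ _ h1 ?_
        filter_upwards [h3] with z hz
        have := Prod.mk.inj hz
        exact hD _ _ _ this.1 this.2
      refine (add_le_add A h3').trans (le_of_eq ?_)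
      rw [Finset.sum_range_succ]
      simp only [(rng _).1, (rng _).2]
      simp only [left]
      have : ∑ k ∈ Finset.range K, ∑' n, D k n * cellExcess r t μ' ν' (k + 1) n =
          ∑ k ∈ Finset.range K, ∑' n, D k n * cellExcess r t μ ν (k + 1) n := by
        refine Finset.sum_congr rfl fun k hk => tsum_congr fun n => ?_
        rw [exc _ (by have := Finset.mem_range.1 hk; omega)]
      rw [this]
      ring

end PartialTransport

/-! ### Mean deviation of the empirical measure on a set. -/

section EmpiricalDeviation

open ProbabilityTheory

/-- The positive part is `(|Z| + Z) / 2`, and the second term has mean zero. -/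
theorem lintegral_ofReal_eq_half_integral_abs {Ω : Type*} [MeasurableSpace Ω] {P : Measure Ω}
    {Z : Ω → ℝ} (hZ : Integrable Z P) (h0 : ∫ ω, Z ω ∂P = 0) :
    ∫⁻ ω, ENNReal.ofReal (Z ω) ∂P = ENNReal.ofReal (2⁻¹ * ∫ ω, |Z ω| ∂P) := by
  have e : ∀ ω, ENNReal.ofReal (Z ω) = ENNReal.ofReal (2⁻¹ * (|Z ω| + Z ω)) := by
    intro ω
    rcases le_total 0 (Z ω) with h | h
    · rw [abs_of_nonneg h]
      congr 1
      ring
    · rw [abs_of_nonpos h, ENNReal.ofReal_of_nonpos h]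
      simp
  simp_rw [e]
  have hi : Integrable (fun ω => 2⁻¹ * (|Z ω| + Z ω)) P := (hZ.abs.add hZ).const_mul _
  rw [← ofReal_integral_eq_lintegral_ofReal hi]
  · rw [integral_const_mul, integral_add hZ.abs hZ, h0, add_zero]
  · refine Filter.Eventually.of_forall fun ω => ?_
    have := neg_abs_le (Z ω)
    simp only [Pi.zero_apply]
    linarith

theorem integral_abs_le_sqrt_integral_sq {Ω : Type*} [MeasurableSpace Ω] {P : Measure Ω}
    [IsProbabilityMeasure P] {Z : Ω → ℝ} (hZ : MemLp Z 2 P) :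
    ∫ ω, |Z ω| ∂P ≤ √(∫ ω, Z ω ^ 2 ∂P) := by
  refine Real.le_sqrt_of_sq_le ?_
  have h := variance_nonneg |Z| P
  rw [variance_eq_sub hZ.abs] at h
  simp only [Pi.pow_apply, Pi.abs_apply, sq_abs] at h
  linarith

variable {d N : ℕ}

theorem empiricalMeasure_apply (x : Fin N → Fin d → ℝ) {A : Set (Fin d → ℝ)}
    (hA : MeasurableSet A) :
    empiricalMeasure x A = (N : ℝ≥0∞)⁻¹ * ∑ j, A.indicator 1 (x j) := by
  simp [empiricalMeasure, Measure.dirac_apply' _ hA]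

theorem isProbabilityMeasure_empiricalMeasure (hN : N ≠ 0) (x : Fin N → Fin d → ℝ) :
    IsProbabilityMeasure (empiricalMeasure x) := by
  constructor
  rw [empiricalMeasure_apply x .univ]
  simp only [Set.indicator_univ, Pi.one_apply, Finset.sum_const, Finset.card_univ,
    Fintype.card_fin, nsmul_eq_mul, mul_one]
  exact ENNReal.inv_mul_cancel (by simpa using hN) (ENNReal.natCast_ne_top N)

theorem measurable_empiricalMeasure_apply {A : Set (Fin d → ℝ)} (hA : MeasurableSet A) :
    Measurable fun x : Fin N → Fin d → ℝ => empiricalMeasure x A := by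
  simp_rw [empiricalMeasure_apply _ hA]
  refine Measurable.const_mul (Finset.measurable_fun_sum _ fun j _ => ?_) _
  exact (measurable_one.indicator hA).comp (measurable_pi_apply j)

variable (μ : Measure (Fin d → ℝ)) [IsProbabilityMeasure μ]

theorem lintegral_empiricalMeasure (hN : N ≠ 0) {A : Set (Fin d → ℝ)} (hA : MeasurableSet A) :
    ∫⁻ x : Fin N → Fin d → ℝ, empiricalMeasure x A ∂(Measure.pi fun _ => μ) = μ A := by
  have hm : Measurable (A.indicator (1 : (Fin d → ℝ) → ℝ≥0∞)) := measurable_one.indicator hA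
  have h : ∀ j : Fin N, ∫⁻ x : Fin N → Fin d → ℝ, A.indicator 1 (x j) ∂(Measure.pi fun _ => μ) =
      μ A := fun j => by
    have := (measurePreserving_eval (fun _ : Fin N => μ) j).lintegral_comp hm
    simp only [Function.eval] at this
    rw [this, lintegral_indicator_one hA]
  simp_rw [empiricalMeasure_apply _ hA]
  have hmj : ∀ j : Fin N, Measurable fun x : Fin N → Fin d → ℝ =>
      A.indicator (1 : (Fin d → ℝ) → ℝ≥0∞) (x j) := fun j => hm.comp (measurable_pi_apply j)
  rw [lintegral_const_mul _ (Finset.measurable_fun_sum _ fun j _ => hmj j),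
    lintegral_finsetSum _ fun j _ => hmj j]
  simp only [h, Finset.sum_const, Finset.card_univ, Fintype.card_fin, nsmul_eq_mul]
  rw [← mul_assoc, ENNReal.inv_mul_cancel (by simpa using hN) (ENNReal.natCast_ne_top N), one_mul]

/-- The indicators of the samples are independent, and an indicator equals its square, so its
variance is at most `μ A`; the mean of `N` of them has variance at most `μ A / N`. -/
theorem integral_abs_empiricalMean_sub_le (hN : N ≠ 0) {A : Set (Fin d → ℝ)}
    (hA : MeasurableSet A) :
    MemLp (fun x : Fin N → Fin d → ℝ => (N : ℝ)⁻¹ * ∑ j, A.indicator (1 : (Fin d → ℝ) → ℝ) (x j)) 2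
      (Measure.pi fun _ => μ) ∧
    ∫ x : Fin N → Fin d → ℝ, (N : ℝ)⁻¹ * ∑ j, A.indicator (1 : (Fin d → ℝ) → ℝ) (x j)
      ∂(Measure.pi fun _ => μ) = μ.real A ∧
    ∫ x : Fin N → Fin d → ℝ, |(N : ℝ)⁻¹ * (∑ j, A.indicator (1 : (Fin d → ℝ) → ℝ) (x j)) - μ.real A|
      ∂(Measure.pi fun _ => μ) ≤ √(μ.real A / N) := by
  have hN' : (N : ℝ) ≠ 0 := by exact_mod_cast hN
  set P : Measure (Fin N → Fin d → ℝ) := Measure.pi fun _ => μ with hP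
  set g : (Fin d → ℝ) → ℝ := A.indicator 1 with hg
  have gm : Measurable g := measurable_one.indicator hA
  have gb : ∀ x, ‖g x‖ ≤ 1 := fun x => by
    by_cases h : x ∈ A <;> simp [hg, h]
  have gL : MemLp g 2 μ := MemLp.of_bound gm.aestronglyMeasurable 1 (Filter.Eventually.of_forall gb)
  have gi : ∫ x, g x ∂μ = μ.real A := integral_indicator_one hA
  have gsq : g ^ 2 = g := by
    ext x
    by_cases h : x ∈ A <;> simp [hg, h]
  have gv : variance g μ ≤ μ.real A := by
    refine (variance_le_expectation_sq gm.aestronglyMeasurable).trans ?_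
    rw [gsq, gi]
  have mp : ∀ j : Fin N, MeasurePreserving (fun x : Fin N → Fin d → ℝ => x j) P μ := fun j =>
    measurePreserving_eval (fun _ : Fin N => μ) j
  have sL : MemLp (∑ j, fun x : Fin N → Fin d → ℝ => g (x j)) 2 P :=
    memLp_finsetSum' _ fun j _ => gL.comp_measurePreserving (mp j)
  have sv : variance (∑ j, fun x : Fin N → Fin d → ℝ => g (x j)) P = N * variance g μ := by
    rw [hP, variance_sum_pi fun _ => gL]
    simp
  have se : (fun x : Fin N → Fin d → ℝ => (N : ℝ)⁻¹ * ∑ j, g (x j)) =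
      fun x => (N : ℝ)⁻¹ * (∑ j, fun x : Fin N → Fin d → ℝ => g (x j)) x := by
    ext x
    simp
  have yL : MemLp (fun x : Fin N → Fin d → ℝ => (N : ℝ)⁻¹ * ∑ j, g (x j)) 2 P := by
    rw [se]
    exact sL.const_mul _
  have yi : ∫ x : Fin N → Fin d → ℝ, (N : ℝ)⁻¹ * ∑ j, g (x j) ∂P = μ.real A := by
    rw [integral_const_mul, integral_finsetSum]
    · have : ∀ j : Fin N, ∫ x : Fin N → Fin d → ℝ, g (x j) ∂P = μ.real A := fun j => by
        rw [← gi, ← (mp j).map_eq, integral_map (mp j).measurable.aemeasurable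
          gm.aestronglyMeasurable]
      simp [this, hN']
    · exact fun j _ => (gL.comp_measurePreserving (mp j)).integrable one_le_two
  refine ⟨yL, yi, ?_⟩
  have zL : MemLp (fun x : Fin N → Fin d → ℝ => (N : ℝ)⁻¹ * (∑ j, g (x j)) - μ.real A) 2 P :=
    yL.sub (memLp_const _)
  refine (integral_abs_le_sqrt_integral_sq zL).trans (Real.sqrt_le_sqrt ?_)
  have := variance_eq_integral yL.1.aemeasurable
  rw [yi] at this
  rw [← this, se, variance_const_mul, sv]
  calc (N : ℝ)⁻¹ ^ 2 * (N * variance g μ) = variance g μ / N := by field_simp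
    _ ≤ μ.real A / N := by gcongr

theorem lintegral_tsub_empiricalMeasure_le (hN : N ≠ 0) {A : Set (Fin d → ℝ)}
    (hA : MeasurableSet A) :
    ∫⁻ x : Fin N → Fin d → ℝ, (μ A - empiricalMeasure x A) ∂(Measure.pi fun _ => μ) ≤
      2⁻¹ * (μ A / N) ^ (1 / 2 : ℝ) ∧
    ∫⁻ x : Fin N → Fin d → ℝ, (empiricalMeasure x A - μ A) ∂(Measure.pi fun _ => μ) ≤
      2⁻¹ * (μ A / N) ^ (1 / 2 : ℝ) := by
  obtain ⟨yL, yi, yb⟩ := integral_abs_empiricalMean_sub_le (N := N) μ hN hA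
  set P : Measure (Fin N → Fin d → ℝ) := Measure.pi fun _ => μ with hP
  set Y : (Fin N → Fin d → ℝ) → ℝ := fun x => (N : ℝ)⁻¹ * ∑ j, A.indicator (1 : (Fin d → ℝ) → ℝ) (x j)
    with hY
  have hYI : Integrable Y P := yL.integrable one_le_two
  have hY0 : ∀ x, 0 ≤ Y x := fun x => by
    refine mul_nonneg (by positivity) (Finset.sum_nonneg fun j _ => ?_)
    exact Set.indicator_nonneg (fun _ _ => zero_le_one) _
  have hNp : (0 : ℝ) < N := by exact_mod_cast Nat.pos_of_ne_zero hN
  have hemp : ∀ x, empiricalMeasure x A = ENNReal.ofReal (Y x) := by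
    intro x
    rw [empiricalMeasure_apply x hA, hY, ENNReal.ofReal_mul (by positivity),
      ENNReal.ofReal_inv_of_pos hNp, ENNReal.ofReal_natCast, ENNReal.ofReal_sum_of_nonneg]
    · congr 2
      ext j
      by_cases h : x j ∈ A <;> simp [h]
    · exact fun j _ => Set.indicator_nonneg (fun _ _ => zero_le_one) _
  have hμ : μ A = ENNReal.ofReal (μ.real A) := (ofReal_measureReal).symm
  have hbound : ENNReal.ofReal (2⁻¹ * √(μ.real A / N)) = 2⁻¹ * (μ A / N) ^ (1 / 2 : ℝ) := by
    rw [ENNReal.ofReal_mul (by positivity), Real.sqrt_eq_rpow, ← ENNReal.ofReal_rpow_of_nonneg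
      (by positivity) (by positivity), ENNReal.ofReal_div_of_pos hNp, ENNReal.ofReal_natCast, ← hμ,
      ENNReal.ofReal_inv_of_pos two_pos, ENNReal.ofReal_ofNat]
  have hc : Integrable (fun _ : Fin N → Fin d → ℝ => μ.real A) P := integrable_const _
  rw [← hbound]
  constructor
  · have e : ∀ x, μ A - empiricalMeasure x A = ENNReal.ofReal (μ.real A - Y x) := fun x => by
      rw [hemp, hμ, ENNReal.ofReal_sub _ (hY0 x)]
    simp_rw [e]
    have hi : Integrable (fun x => μ.real A - Y x) P := hc.sub hYI
    rw [lintegral_ofReal_eq_half_integral_abs hi]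
    · simp_rw [abs_sub_comm (μ.real A)]
      gcongr
    · rw [integral_sub hc hYI, yi]
      simp
  · have e : ∀ x, empiricalMeasure x A - μ A = ENNReal.ofReal (Y x - μ.real A) := fun x => by
      rw [hemp, hμ, ENNReal.ofReal_sub _ measureReal_nonneg]
    simp_rw [e]
    have hi : Integrable (fun x => Y x - μ.real A) P := hYI.sub hc
    rw [lintegral_ofReal_eq_half_integral_abs hi]
    · gcongr
    · rw [integral_sub hYI hc, yi]
      simp

end EmpiricalDeviation

/-! ### A dyadic sum with a crossover. -/

section DyadicSums

theorem two_pow_rpow_eq (k : ℕ) (a : ℝ) : ((2 : ℝ) ^ k) ^ a = ((2 : ℝ) ^ a) ^ k := by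
  rw [← Real.rpow_natCast, ← Real.rpow_natCast, ← Real.rpow_mul zero_le_two,
    ← Real.rpow_mul zero_le_two, mul_comm]

theorem geom_sum_le_of_lt_one {x : ℝ} (h0 : 0 ≤ x) (h1 : x < 1) (K : ℕ) :
    ∑ k ∈ Finset.range K, x ^ k ≤ 1 / (1 - x) := by
  rw [geom_sum_eq h1.ne, ← neg_div_neg_eq, neg_sub, neg_sub]
  have : 0 < 1 - x := by linarith
  gcongr
  have := pow_nonneg h0 K
  linarith

/-- Split at the first `m` with `t < 2 ^ m`. Below it the power bound grows geometrically with ratio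
`2 ^ (α - p)`; above it the bound `1` leaves a series of ratio `2 ^ (-p)`. Both are of order `t ^
(-p)` at the crossover. -/
theorem sum_dyadic_min_le {α p t : ℝ} (hp : 0 < p) (hα : p < α) (ht : 0 < t) (K : ℕ) :
    ∑ k ∈ Finset.range K, ((2 : ℝ) ^ k) ^ (-p) * min (((2 : ℝ) ^ k / t) ^ α) 1 ≤
      (1 / (1 - (2 : ℝ) ^ (p - α)) + 1 / (1 - (2 : ℝ) ^ (-p))) * t ^ (-p) := by
  have hex : ∃ m : ℕ, t < 2 ^ m := pow_unbounded_of_one_lt t one_lt_two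
  obtain ⟨m, hm, hmin⟩ : ∃ m : ℕ, t < 2 ^ m ∧ ∀ k < m, (2 : ℝ) ^ k ≤ t :=
    ⟨Nat.find hex, Nat.find_spec hex, fun k hk => not_lt.1 (Nat.find_min hex hk)⟩
  have hσ1 : (2 : ℝ) ^ (-p) < 1 := Real.rpow_lt_one_of_one_lt_of_neg one_lt_two (by linarith)
  have hr1 : (2 : ℝ) ^ (p - α) < 1 := Real.rpow_lt_one_of_one_lt_of_neg one_lt_two (by linarith)
  have hr0 : (0 : ℝ) < (2 : ℝ) ^ (p - α) := by positivity
  have low : ∑ k ∈ Finset.range m, ((2 : ℝ) ^ k) ^ (-p) * min (((2 : ℝ) ^ k / t) ^ α) 1 ≤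
      1 / (1 - (2 : ℝ) ^ (p - α)) * t ^ (-p) := by
    rcases m with _ | j
    · simp only [Finset.range_zero, Finset.sum_empty]
      have : 0 < 1 - (2 : ℝ) ^ (p - α) := by linarith
      positivity
    -- Counting downwards from the last index below the crossover makes the ratio `2 ^ (p - α) < 1`.
    · rw [← Finset.sum_range_reflect]
      calc ∑ i ∈ Finset.range (j + 1), ((2 : ℝ) ^ (j + 1 - 1 - i)) ^ (-p) *
              min (((2 : ℝ) ^ (j + 1 - 1 - i) / t) ^ α) 1
          ≤ ∑ i ∈ Finset.range (j + 1), ((2 : ℝ) ^ (p - α)) ^ i * t ^ (-p) := by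
            refine Finset.sum_le_sum fun i hi => ?_
            have hij : i ≤ j := Nat.lt_succ_iff.1 (Finset.mem_range.1 hi)
            obtain ⟨l, rfl⟩ := Nat.exists_eq_add_of_le hij
            have e : i + l + 1 - 1 - i = l := by omega
            rw [e, ← two_pow_rpow_eq]
            have h2 : (2 : ℝ) ^ (i + l) ≤ t := hmin _ (by omega)
            calc ((2 : ℝ) ^ l) ^ (-p) * min (((2 : ℝ) ^ l / t) ^ α) 1
                ≤ ((2 : ℝ) ^ l) ^ (-p) * ((2 : ℝ) ^ l / t) ^ α := by
                  gcongr
                  exact min_le_left _ _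
              _ = ((2 : ℝ) ^ l) ^ (α - p) * t ^ (p - α) * t ^ (-p) := by
                  rw [Real.div_rpow (by positivity) ht.le, sub_eq_add_neg α p,
                    Real.rpow_add (by positivity), mul_assoc _ (t ^ (p - α)), ← Real.rpow_add ht,
                    show p - α + -p = -α by ring, Real.rpow_neg ht.le]
                  ring
              _ ≤ ((2 : ℝ) ^ l) ^ (α - p) * ((2 : ℝ) ^ (i + l)) ^ (p - α) * t ^ (-p) := by
                  gcongr ?_ * ?_ * ?_
                  exact Real.rpow_le_rpow_of_nonpos (by positivity) h2 (by linarith)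
              _ = ((2 : ℝ) ^ i) ^ (p - α) * t ^ (-p) := by
                  rw [pow_add, Real.mul_rpow (by positivity) (by positivity),
                    mul_comm (((2 : ℝ) ^ i) ^ (p - α)), ← mul_assoc, ← Real.rpow_add (by positivity),
                    show α - p + (p - α) = 0 by ring, Real.rpow_zero, one_mul]
        _ ≤ _ := by
            rw [← Finset.sum_mul]
            gcongr
            exact geom_sum_le_of_lt_one hr0.le hr1 _
  have high : ∑ i ∈ Finset.range K, ((2 : ℝ) ^ (m + i)) ^ (-p) *
      min (((2 : ℝ) ^ (m + i) / t) ^ α) 1 ≤ 1 / (1 - (2 : ℝ) ^ (-p)) * t ^ (-p) := by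
    calc ∑ i ∈ Finset.range K, ((2 : ℝ) ^ (m + i)) ^ (-p) * min (((2 : ℝ) ^ (m + i) / t) ^ α) 1
        ≤ ∑ i ∈ Finset.range K, ((2 : ℝ) ^ (-p)) ^ i * t ^ (-p) := by
          refine Finset.sum_le_sum fun i _ => ?_
          rw [pow_add, Real.mul_rpow (by positivity) (by positivity), two_pow_rpow_eq i]
          calc ((2 : ℝ) ^ m) ^ (-p) * ((2 : ℝ) ^ (-p)) ^ i *
                min (((2 : ℝ) ^ m * 2 ^ i / t) ^ α) 1
              ≤ ((2 : ℝ) ^ m) ^ (-p) * ((2 : ℝ) ^ (-p)) ^ i * 1 := by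
                gcongr
                exact min_le_right _ _
            _ ≤ t ^ (-p) * ((2 : ℝ) ^ (-p)) ^ i * 1 := by
                gcongr ?_ * ?_ * ?_
                exact Real.rpow_le_rpow_of_nonpos ht hm.le (by linarith)
            _ = _ := by ring
      _ ≤ _ := by
          rw [← Finset.sum_mul]
          gcongr
          exact geom_sum_le_of_lt_one (by positivity) hσ1 _
  -- Lengthening the range to `m + K` allows the split at `m` even when `K < m`.
  calc ∑ k ∈ Finset.range K, ((2 : ℝ) ^ k) ^ (-p) * min (((2 : ℝ) ^ k / t) ^ α) 1
      ≤ ∑ k ∈ Finset.range (m + K), ((2 : ℝ) ^ k) ^ (-p) * min (((2 : ℝ) ^ k / t) ^ α) 1 := by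
        refine Finset.sum_le_sum_of_subset_of_nonneg
          (Finset.range_subset_range.2 (Nat.le_add_left _ _)) fun k _ _ => ?_
        have : 0 ≤ min (((2 : ℝ) ^ k / t) ^ α) 1 := le_min (by positivity) zero_le_one
        positivity
    _ ≤ _ := by
        rw [Finset.sum_range_add, add_mul]
        exact add_le_add low high

end DyadicSums

/-! ### Dyadic rings and their cells. -/

section DyadicRings

variable {d : ℕ}

/-- The index `n` of the ring `s 2^(n-1) ≤ ‖x‖ < s 2^n` (`‖x‖ < s` for `n = 0`) containing `x`. -/
noncomputable def ringIndex (s : ℝ) (x : Fin d → ℝ) : ℕ := Nat.size ⌊‖x‖ / s⌋₊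

/-- The index of the cell of `x` when the cube of side `s 2^(n+1)` around the `n`-th ring is cut
into `2^(kd)` equal cubes. -/
noncomputable def cellIndex (s : ℝ) (k : ℕ) (x : Fin d → ℝ) : Fin d → ℕ :=
  fun i => ⌊(2 : ℝ) ^ k * ((x i / (s * 2 ^ ringIndex s x) + 1) / 2)⌋₊

theorem measurable_ringIndex (s : ℝ) : Measurable (ringIndex s : (Fin d → ℝ) → ℕ) :=
  (measurable_of_countable Nat.size).comp
    (Nat.measurable_floor.comp (measurable_norm.div_const s))

theorem measurable_cellIndex (s : ℝ) (k : ℕ) :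
    Measurable (cellIndex s k : (Fin d → ℝ) → Fin d → ℕ) := by
  refine measurable_pi_lambda _ fun i => Nat.measurable_floor.comp ?_
  have : Measurable fun x : Fin d → ℝ => s * (2 : ℝ) ^ ringIndex s x :=
    (measurable_of_countable fun n : ℕ => s * (2 : ℝ) ^ n).comp (measurable_ringIndex s)
  exact ((((measurable_pi_apply i).div this).add_const 1).div_const 2).const_mul _

/-- `Nat.size m` is the least `n` with `m < 2 ^ n`; powers of two being integers, the floor loses
nothing. -/
theorem norm_lt_of_ringIndex {s : ℝ} (hs : 0 < s) (x : Fin d → ℝ) :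
    ‖x‖ < s * 2 ^ ringIndex s x := by
  have h : ⌊‖x‖ / s⌋₊ < 2 ^ ringIndex s x := Nat.lt_size_self _
  rw [Nat.floor_lt (by positivity), div_lt_iff₀ hs] at h
  push_cast at h
  linarith

theorem le_norm_of_ringIndex {s : ℝ} (hs : 0 < s) {x : Fin d → ℝ} {n : ℕ}
    (hx : ringIndex s x = n + 1) : s * 2 ^ n ≤ ‖x‖ := by
  have h : n < Nat.size ⌊‖x‖ / s⌋₊ := by
    change n < ringIndex s x
    omega
  rw [Nat.lt_size, Nat.le_floor_iff (by positivity), le_div_iff₀ hs] at h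
  push_cast at h
  linarith

theorem normalized_coord_mem {s : ℝ} (hs : 0 < s) (x : Fin d → ℝ) (i : Fin d) :
    0 ≤ (x i / (s * 2 ^ ringIndex s x) + 1) / 2 ∧ (x i / (s * 2 ^ ringIndex s x) + 1) / 2 < 1 := by
  have h0 : 0 < s * (2 : ℝ) ^ ringIndex s x := by positivity
  have h1 : |x i| < s * 2 ^ ringIndex s x :=
    (norm_le_pi_norm x i).trans_lt (norm_lt_of_ringIndex hs x)
  obtain ⟨h2, h3⟩ := abs_lt.1 h1
  have h4 : x i / (s * 2 ^ ringIndex s x) < 1 := (div_lt_one h0).2 h3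
  have h5 : -1 < x i / (s * 2 ^ ringIndex s x) := by
    rw [lt_div_iff₀ h0]
    linarith
  constructor <;> linarith

theorem cellIndex_lt {s : ℝ} (hs : 0 < s) (k : ℕ) (x : Fin d → ℝ) (i : Fin d) :
    cellIndex s k x i < 2 ^ k := by
  obtain ⟨h0, h1⟩ := normalized_coord_mem hs x i
  rw [cellIndex, Nat.floor_lt (by positivity)]
  push_cast
  exact mul_lt_of_lt_one_right (by positivity) h1

theorem cellIndex_zero {s : ℝ} (hs : 0 < s) (x : Fin d → ℝ) : cellIndex s 0 x = 0 := by
  ext i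
  have := cellIndex_lt hs 0 x i
  simpa using this

theorem cellIndex_eq_div_two (s : ℝ) (k : ℕ) (x : Fin d → ℝ) (i : Fin d) :
    cellIndex s k x i = cellIndex s (k + 1) x i / 2 := by
  rw [cellIndex, cellIndex, ← Nat.floor_div_ofNat]
  congr 1
  rw [pow_succ]
  ring

theorem norm_sub_le_of_cellIndex_eq {s : ℝ} (hs : 0 < s) {k : ℕ} {x y : Fin d → ℝ}
    (hr : ringIndex s x = ringIndex s y) (hc : cellIndex s k x = cellIndex s k y) :
    ‖x - y‖ ≤ s * 2 ^ (ringIndex s x + 1) * ((2 : ℝ) ^ k)⁻¹ := by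
  refine (pi_norm_le_iff_of_nonneg (by positivity)).2 fun i => ?_
  have hx := (normalized_coord_mem hs x i).1
  have hy := (normalized_coord_mem hs y i).1
  have hi : cellIndex s k x i = cellIndex s k y i := congrFun hc i
  simp only [cellIndex] at hi
  rw [← hr] at hi hy
  set R := s * (2 : ℝ) ^ ringIndex s x with hR
  have hRp : 0 < R := by positivity
  have hkp : (0 : ℝ) < 2 ^ k := by positivity
  have x1 := Nat.floor_le (mul_nonneg hkp.le hx)
  have x2 := Nat.lt_floor_add_one ((2 : ℝ) ^ k * ((x i / R + 1) / 2))
  have y1 := Nat.floor_le (mul_nonneg hkp.le hy)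
  have y2 := Nat.lt_floor_add_one ((2 : ℝ) ^ k * ((y i / R + 1) / 2))
  rw [hi] at x1 x2
  have e : x i - y i = R * 2 * ((2 : ℝ) ^ k)⁻¹ * ((2 : ℝ) ^ k * ((x i / R + 1) / 2) -
      (2 : ℝ) ^ k * ((y i / R + 1) / 2)) := by
    field_simp
    ring
  rw [Pi.sub_apply, Real.norm_eq_abs, e, abs_mul, abs_of_pos (by positivity : 0 < R * 2 * (2 ^ k)⁻¹),
    pow_succ, ← mul_assoc, ← hR]
  refine mul_le_of_le_one_right (by positivity) (abs_le.2 ⟨?_, ?_⟩) <;> linarith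

/-- Markov's inequality. The factor `2 ^ q` appears because ring `n` begins at radius `s * 2 ^ (n -
1)`; ring `0` only uses total mass one. -/
theorem measure_ring_le {s q : ℝ} (hs : 0 < s) (hq : 0 < q) (μ : Measure (Fin d → ℝ))
    [IsProbabilityMeasure μ] (hM : absMoment (maxNorm d) q μ ≤ ENNReal.ofReal (s ^ q)) (n : ℕ) :
    μ.real (ringIndex s ⁻¹' {n}) ≤ 2 ^ q * ((2 : ℝ) ^ n) ^ (-q) := by
  rcases n with _ | n
  · refine measureReal_le_one.trans ?_
    simpa using Real.one_le_rpow one_le_two hq.le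
  · have hA : MeasurableSet (ringIndex s ⁻¹' {n + 1} : Set (Fin d → ℝ)) :=
      measurable_ringIndex s (measurableSet_singleton _)
    have h : ENNReal.ofReal ((s * 2 ^ n) ^ q) * μ (ringIndex s ⁻¹' {n + 1}) ≤
        ENNReal.ofReal (s ^ q) := by
      refine le_trans ?_ hM
      rw [← setLIntegral_const]
      refine (setLIntegral_mono' hA fun x hx => ?_).trans (setLIntegral_le_lintegral _ _)
      have := le_norm_of_ringIndex hs hx
      exact ENNReal.ofReal_le_ofReal (Real.rpow_le_rpow (by positivity) this hq.le)
    rw [← ofReal_measureReal (μ := μ), ← ENNReal.ofReal_mul (by positivity),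
      ENNReal.ofReal_le_ofReal_iff (by positivity), Real.mul_rpow hs.le (by positivity)] at h
    have hsq : 0 < s ^ q := by positivity
    have h' : ((2 : ℝ) ^ n) ^ q * μ.real (ringIndex s ⁻¹' {n + 1}) ≤ 1 := by
      refine le_of_mul_le_mul_left ?_ hsq
      linarith
    rw [pow_succ, Real.mul_rpow (by positivity) zero_le_two, mul_left_comm,
      ← Real.rpow_add two_pos, add_neg_cancel, Real.rpow_zero, mul_one,
      Real.rpow_neg (by positivity), ← one_div, le_div_iff₀ (by positivity)]
    linarith

end DyadicRings

/-! ### Expected cost of the multiscale coupling. -/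

section ExpectedCost

theorem ENNReal.sum_rpow_half_le {ι : Type*} (F : Finset ι) (f : ι → ℝ≥0∞) :
    ∑ i ∈ F, f i ^ (1 / 2 : ℝ) ≤ (F.card * ∑ i ∈ F, f i) ^ (1 / 2 : ℝ) := by
  have h := ENNReal.rpow_sum_le_const_mul_sum_rpow F (fun i => f i ^ (1 / 2 : ℝ)) one_le_two
  rw [show (2 : ℝ) - 1 = 1 by norm_num, ENNReal.rpow_one] at h
  simp_rw [← ENNReal.rpow_mul] at h
  norm_num at h
  have h2 := ENNReal.rpow_le_rpow h (by norm_num : (0 : ℝ) ≤ 1 / 2)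
  rwa [← ENNReal.rpow_natCast, ← ENNReal.rpow_mul, show ((2 : ℕ) : ℝ) * (1 / 2) = 1 by norm_num,
    ENNReal.rpow_one] at h2

theorem real_rpow_add_le_mul_rpow_add_rpow {a b p : ℝ} (ha : 0 ≤ a) (hb : 0 ≤ b) (hp : 1 ≤ p) :
    (a + b) ^ p ≤ 2 ^ (p - 1) * (a ^ p + b ^ p) := by
  lift a to NNReal using ha
  lift b to NNReal using hb
  exact_mod_cast NNReal.rpow_add_le_mul_rpow_add_rpow a b hp

theorem tsum_ofReal_dyadic {e c : ℝ} (he : 0 < e) (hc : 0 ≤ c) :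
    ∑' n : ℕ, ENNReal.ofReal (c * ((2 : ℝ) ^ n) ^ (-e)) =
      ENNReal.ofReal (c / (1 - (2 : ℝ) ^ (-e))) := by
  have h1 : (2 : ℝ) ^ (-e) < 1 := Real.rpow_lt_one_of_one_lt_of_neg one_lt_two (by linarith)
  have h0 : (0 : ℝ) ≤ (2 : ℝ) ^ (-e) := by positivity
  simp_rw [two_pow_rpow_eq]
  rw [← ENNReal.ofReal_tsum_of_nonneg (fun n => by positivity)
    ((summable_geometric_of_lt_one h0 h1).mul_left c), tsum_mul_left,
    tsum_geometric_of_lt_one h0 h1, div_eq_mul_inv]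

variable {d N : ℕ} (μ : Measure (Fin d → ℝ))

theorem measurable_ring_cell (s : ℝ) (k : ℕ) :
    Measurable fun x : Fin d → ℝ => (ringIndex s x, cellIndex s k x) :=
  (measurable_ringIndex s).prodMk (measurable_cellIndex s k)

theorem tsum_cell_eq_ring (s : ℝ) (k n : ℕ) :
    ∑' f, μ ((fun x => (ringIndex s x, cellIndex s k x)) ⁻¹' {(n, f)}) =
      μ (ringIndex s ⁻¹' {n}) := by
  rw [measure_eq_tsum_inter_fiber μ (measurable_cellIndex s k)
    (measurable_ringIndex s (measurableSet_singleton n))]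
  refine tsum_congr fun f => ?_
  congr 1
  ext x
  simp

theorem measurable_cellExcess_empiricalMeasure (s : ℝ) (k n : ℕ) :
    Measurable fun x : Fin N → Fin d → ℝ =>
      cellExcess (ringIndex s) (cellIndex s) μ (empiricalMeasure x) k n := by
  refine Measurable.tsum fun f => ?_
  exact measurable_const.sub
    (measurable_empiricalMeasure_apply (measurable_ring_cell s k (measurableSet_singleton _)))

variable [IsProbabilityMeasure μ]

theorem lintegral_cellExcess_le_ring (s : ℝ) (k n : ℕ) :
    ∫⁻ x : Fin N → Fin d → ℝ, cellExcess (ringIndex s) (cellIndex s) μ (empiricalMeasure x) k n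
      ∂(Measure.pi fun _ => μ) ≤ μ (ringIndex s ⁻¹' {n}) := by
  calc _ ≤ ∫⁻ x : Fin N → Fin d → ℝ, μ (ringIndex s ⁻¹' {n}) ∂(Measure.pi fun _ => μ) := by
        refine lintegral_mono fun x => ?_
        rw [← tsum_cell_eq_ring μ s k n]
        exact ENNReal.tsum_le_tsum fun f => tsub_le_self
    _ = _ := by simp

/-- Only `2 ^ (k * d)` cells can be nonempty, and Cauchy–Schwarz bounds the sum of the square roots
of their masses. -/
theorem lintegral_cellExcess_le_sqrt (hN : N ≠ 0) {s : ℝ} (hs : 0 < s) (k n : ℕ) :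
    ∫⁻ x : Fin N → Fin d → ℝ, cellExcess (ringIndex s) (cellIndex s) μ (empiricalMeasure x) k n
      ∂(Measure.pi fun _ => μ) ≤
      2⁻¹ * (2 ^ (k * d) * (μ (ringIndex s ⁻¹' {n}) / N)) ^ (1 / 2 : ℝ) := by
  set C : (Fin d → ℕ) → Set (Fin d → ℝ) := fun f =>
    (fun x => (ringIndex s x, cellIndex s k x)) ⁻¹' {(n, f)} with hC
  have hCm : ∀ f, MeasurableSet (C f) := fun f =>
    measurable_ring_cell s k (measurableSet_singleton _)
  set F : Finset (Fin d → ℕ) := Fintype.piFinset fun _ => Finset.range (2 ^ k) with hF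
  have hFc : (F.card : ℝ≥0∞) = 2 ^ (k * d) := by
    simp [hF, pow_mul]
  have hemp : ∀ f ∉ F, C f = ∅ := by
    intro f hf
    refine Set.eq_empty_of_forall_notMem fun x hx => hf ?_
    have := (Prod.mk.inj (Set.mem_singleton_iff.1 hx)).2
    rw [hF, Fintype.mem_piFinset]
    intro i
    rw [← this, Finset.mem_range]
    exact cellIndex_lt hs k x i
  have hfin : ∀ ν : Measure (Fin d → ℝ),
      cellExcess (ringIndex s) (cellIndex s) μ ν k n = ∑ f ∈ F, (μ (C f) - ν (C f)) := by
    intro ν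
    refine tsum_eq_sum fun f hf => ?_
    change μ (C f) - ν (C f) = 0
    rw [hemp f hf]
    simp
  have hdm : ∀ f, Measurable fun x : Fin N → Fin d → ℝ => μ (C f) - empiricalMeasure x (C f) :=
    fun f => measurable_const.sub (measurable_empiricalMeasure_apply (hCm f))
  simp_rw [hfin]
  rw [lintegral_finsetSum _ fun f _ => hdm f]
  calc _ ≤ ∑ f ∈ F, 2⁻¹ * (μ (C f) / N) ^ (1 / 2 : ℝ) :=
        Finset.sum_le_sum fun f _ => (lintegral_tsub_empiricalMeasure_le μ hN (hCm f)).1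
    _ ≤ 2⁻¹ * (F.card * ∑ f ∈ F, μ (C f) / N) ^ (1 / 2 : ℝ) := by
        rw [← Finset.mul_sum]
        gcongr
        exact ENNReal.sum_rpow_half_le _ _
    _ ≤ _ := by
        rw [hFc]
        gcongr
        simp_rw [div_eq_mul_inv]
        rw [← Finset.sum_mul]
        gcongr
        rw [← tsum_cell_eq_ring μ s k n]
        exact ENNReal.sum_le_tsum F

/-- The constant governing the quantization of measures on a cube of side one. -/
noncomputable def cubeConst (d : ℕ) (p : ℝ) : ℝ :=
  (2 : ℝ) ^ ((d : ℝ) / 2 - 1) *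
    (1 / (1 - (2 : ℝ) ^ (p - (d : ℝ) / 2)) + 1 / (1 - (2 : ℝ) ^ (-p)))

/-- The `p`-th power of the diameter of the cells of level `k` in the `n`-th ring. -/
noncomputable def cellCost (s p : ℝ) (k n : ℕ) : ℝ≥0∞ :=
  ENNReal.ofReal ((s * 2 ^ (n + 1) * ((2 : ℝ) ^ k)⁻¹) ^ p)

theorem cellCost_eq {s p : ℝ} (hs : 0 < s) (k n : ℕ) :
    cellCost s p k n =
      ENNReal.ofReal (((2 : ℝ) ^ k) ^ (-p)) * ENNReal.ofReal ((s * 2 ^ (n + 1)) ^ p) := by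
  rw [cellCost, ← ENNReal.ofReal_mul (by positivity), Real.mul_rpow (by positivity) (by positivity),
    Real.inv_rpow (by positivity), Real.rpow_neg (by positivity), mul_comm]

theorem one_le_cubeConst {p : ℝ} (hd : 2 ≤ d) (hp : 0 < p) (hpd : p < (d : ℝ) / 2) :
    1 ≤ cubeConst d p := by
  have hσ1 : (2 : ℝ) ^ (-p) < 1 := Real.rpow_lt_one_of_one_lt_of_neg one_lt_two (by linarith)
  have hr1 : (2 : ℝ) ^ (p - (d : ℝ) / 2) < 1 :=
    Real.rpow_lt_one_of_one_lt_of_neg one_lt_two (by linarith)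
  have hr0 : (0 : ℝ) < (2 : ℝ) ^ (p - (d : ℝ) / 2) := by positivity
  have hd' : (2 : ℝ) ≤ d := by exact_mod_cast hd
  have h1 : 1 ≤ (2 : ℝ) ^ ((d : ℝ) / 2 - 1) := Real.one_le_rpow one_le_two (by linarith)
  have h2 : 1 ≤ 1 / (1 - (2 : ℝ) ^ (p - (d : ℝ) / 2)) := by
    rw [le_div_iff₀ (by linarith)]
    linarith
  have h3 : 0 ≤ 1 / (1 - (2 : ℝ) ^ (-p)) := by
    have : 0 < 1 - (2 : ℝ) ^ (-p) := by linarith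
    positivity
  rw [cubeConst]
  nlinarith

theorem sum_cellCost_mul_lintegral_cellExcess_le {s p : ℝ} (hd : 2 ≤ d) (hN : N ≠ 0) (hs : 0 < s)
    (hp : 0 < p) (hpd : p < (d : ℝ) / 2) (K n : ℕ) :
    ∑ k ∈ Finset.range K, cellCost s p k n *
      ∫⁻ x : Fin N → Fin d → ℝ,
        cellExcess (ringIndex s) (cellIndex s) μ (empiricalMeasure x) (k + 1) n
        ∂(Measure.pi fun _ => μ) ≤
      ENNReal.ofReal ((s * 2 ^ (n + 1)) ^ p * cubeConst d p * (N : ℝ) ^ (-(p / d)) *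
        μ.real (ringIndex s ⁻¹' {n}) ^ (1 - p / d)) := by
  have hdp : (0 : ℝ) < d := by
    have : (2 : ℝ) ≤ d := by exact_mod_cast hd
    linarith
  have hNp : (0 : ℝ) < N := by exact_mod_cast Nat.pos_of_ne_zero hN
  set m : ℝ := μ.real (ringIndex s ⁻¹' {n}) with hm
  have hμ : μ (ringIndex s ⁻¹' {n}) = ENNReal.ofReal m := (ofReal_measureReal).symm
  have E1 := fun k => lintegral_cellExcess_le_ring (N := N) μ s (k + 1) n
  have E2 := fun k => lintegral_cellExcess_le_sqrt μ hN hs (k + 1) n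
  rw [hμ] at E1 E2
  have hm0 : 0 ≤ m := measureReal_nonneg
  rcases hm0.eq_or_lt with h0 | hpos
  · rw [← h0, ENNReal.ofReal_zero] at E1
    refine le_trans (le_of_eq (Finset.sum_eq_zero fun k _ => ?_)) bot_le
    rw [le_antisymm (E1 k) bot_le, mul_zero]
  -- At `2 ^ k = t` there are as many cells as expected samples in the ring.
  · set t : ℝ := (m * N) ^ (1 / (d : ℝ)) with ht
    have htp : 0 < t := by positivity
    -- The factor `2 ^ (d/2 - 1)` combines the half of the one-sided deviation with `2 ^ (d/2)` from
    -- using level `k + 1`. Since it is at least one, it may also multiply the trivial bound `m`.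
    have E : ∀ k, ∫⁻ x : Fin N → Fin d → ℝ,
        cellExcess (ringIndex s) (cellIndex s) μ (empiricalMeasure x) (k + 1) n
        ∂(Measure.pi fun _ => μ) ≤
        ENNReal.ofReal ((2 : ℝ) ^ ((d : ℝ) / 2 - 1) * m *
          min (((2 : ℝ) ^ k / t) ^ ((d : ℝ) / 2)) 1) := by
      intro k
      rw [mul_min_of_nonneg _ _ (by positivity), ENNReal.ofReal_min, le_min_iff]
      constructor
      · refine (E2 k).trans (le_of_eq ?_)
        have e1 : t ^ ((d : ℝ) / 2) = (m * N) ^ (1 / 2 : ℝ) := by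
          rw [ht, ← Real.rpow_mul (by positivity)]
          congr 1
          field_simp
        have e2 : ((2 : ℝ) ^ ((k + 1) * d)) ^ (1 / 2 : ℝ) =
            2 ^ ((d : ℝ) / 2) * ((2 : ℝ) ^ k) ^ ((d : ℝ) / 2) := by
          rw [← Real.mul_rpow (by positivity) (by positivity), ← pow_succ', pow_mul,
            ← Real.rpow_natCast _ d, ← Real.rpow_mul (by positivity)]
          congr 1
          ring
        have e3 : (m / N) ^ (1 / 2 : ℝ) = m * ((m * N) ^ (1 / 2 : ℝ))⁻¹ := by
          rw [← Real.sqrt_eq_rpow, ← Real.sqrt_eq_rpow, Real.sqrt_div hpos.le,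
            Real.sqrt_mul hpos.le]
          have := Real.mul_self_sqrt hpos.le
          have h1 : 0 < √m := Real.sqrt_pos.2 hpos
          have h2 : 0 < √(N : ℝ) := Real.sqrt_pos.2 hNp
          field_simp
          nlinarith
        rw [← ENNReal.ofReal_natCast N, ← ENNReal.ofReal_div_of_pos hNp,
          show (2 : ℝ≥0∞) ^ ((k + 1) * d) = ENNReal.ofReal ((2 : ℝ) ^ ((k + 1) * d)) by
            rw [ENNReal.ofReal_pow zero_le_two, ENNReal.ofReal_ofNat],
          ← ENNReal.ofReal_mul (by positivity),
          ENNReal.ofReal_rpow_of_nonneg (by positivity) (by positivity),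
          show (2 : ℝ≥0∞)⁻¹ = ENNReal.ofReal (2⁻¹) by
            rw [ENNReal.ofReal_inv_of_pos two_pos, ENNReal.ofReal_ofNat],
          ← ENNReal.ofReal_mul (by positivity), Real.mul_rpow (by positivity) (by positivity),
          e2, e3, Real.div_rpow (by positivity) htp.le, e1, Real.rpow_sub two_pos, Real.rpow_one]
        congr 1
        ring
      · refine (E1 k).trans (ENNReal.ofReal_le_ofReal ?_)
        have hd' : (2 : ℝ) ≤ d := by exact_mod_cast hd
        have h1 : 1 ≤ (2 : ℝ) ^ ((d : ℝ) / 2 - 1) := Real.one_le_rpow one_le_two (by linarith)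
        nlinarith
    have hS := sum_dyadic_min_le hp hpd htp K
    have e4 : m * t ^ (-p) = (N : ℝ) ^ (-(p / d)) * m ^ (1 - p / d) := by
      rw [ht, ← Real.rpow_mul (by positivity), Real.mul_rpow hpos.le hNp.le,
        show 1 / (d : ℝ) * -p = -(p / d) by ring, sub_eq_add_neg, Real.rpow_add hpos, Real.rpow_one]
      ring
    have hmin : ∀ k : ℕ, 0 ≤ min (((2 : ℝ) ^ k / t) ^ ((d : ℝ) / 2)) 1 := fun k =>
      le_min (by positivity) zero_le_one
    calc _ ≤ ∑ k ∈ Finset.range K, ENNReal.ofReal ((s * 2 ^ (n + 1)) ^ p *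
            (2 : ℝ) ^ ((d : ℝ) / 2 - 1) * m *
            (((2 : ℝ) ^ k) ^ (-p) * min (((2 : ℝ) ^ k / t) ^ ((d : ℝ) / 2)) 1)) := by
          refine Finset.sum_le_sum fun k _ => ?_
          refine (mul_le_mul_right (E k) _).trans (le_of_eq ?_)
          rw [cellCost_eq hs, ← ENNReal.ofReal_mul (by positivity),
            ← ENNReal.ofReal_mul (by positivity)]
          congr 1
          ring
      _ = ENNReal.ofReal ((s * 2 ^ (n + 1)) ^ p * (2 : ℝ) ^ ((d : ℝ) / 2 - 1) * m *
            ∑ k ∈ Finset.range K,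
              ((2 : ℝ) ^ k) ^ (-p) * min (((2 : ℝ) ^ k / t) ^ ((d : ℝ) / 2)) 1) := by
          rw [← ENNReal.ofReal_sum_of_nonneg, ← Finset.mul_sum]
          intro k _
          have := hmin k
          positivity
      _ ≤ _ := by
          refine ENNReal.ofReal_le_ofReal ?_
          refine (mul_le_mul_of_nonneg_left hS (by positivity)).trans (le_of_eq ?_)
          rw [cubeConst, mul_assoc _ _ (m ^ (1 - p / d)), ← e4]
          ring

theorem wasserstein_rpow_le {s p : ℝ} (hN : N ≠ 0) (hs : 0 < s) (hp : 1 ≤ p) (K : ℕ)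
    (x : Fin N → Fin d → ℝ) :
    wasserstein (maxNorm d) p μ (empiricalMeasure x) ^ p ≤
      ∑' n, cellCost s p K n * μ (ringIndex s ⁻¹' {n}) +
      ∑ k ∈ Finset.range K, ∑' n, cellCost s p k n *
        cellExcess (ringIndex s) (cellIndex s) μ (empiricalMeasure x) (k + 1) n +
      ∑' n, ENNReal.ofReal (2 ^ (p - 1) * (s * 2 ^ n) ^ p) *
        ((μ (ringIndex s ⁻¹' {n}) - empiricalMeasure x (ringIndex s ⁻¹' {n})) +
          (empiricalMeasure x (ringIndex s ⁻¹' {n}) - μ (ringIndex s ⁻¹' {n}))) := by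
  have hp0 : 0 < p := by linarith
  have := isProbabilityMeasure_empiricalMeasure hN x
  obtain ⟨ξ, h1, h2, h3⟩ := exists_transport_le_cellExcess (measurable_ringIndex (d := d) s)
    (measurable_cellIndex s) (fun x y _ => (cellIndex_zero hs x).trans (cellIndex_zero hs y).symm)
    (fun k x y _ h => by
      ext i
      rw [cellIndex_eq_div_two, h, ← cellIndex_eq_div_two])
    (c := fun x y => ENNReal.ofReal (maxNorm d (x - y) ^ p)) (D := cellCost s p)
    (a := fun n => ENNReal.ofReal (2 ^ (p - 1) * (s * 2 ^ n) ^ p))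
    (fun k x y hr hc => by
      refine ENNReal.ofReal_le_ofReal (Real.rpow_le_rpow (apply_nonneg _ _) ?_ hp0.le)
      exact norm_sub_le_of_cellIndex_eq hs hr hc)
    (fun x y => by
      rw [← ENNReal.ofReal_add (by positivity) (by positivity), ← mul_add]
      refine ENNReal.ofReal_le_ofReal ?_
      calc ‖x - y‖ ^ p ≤ (s * 2 ^ ringIndex s x + s * 2 ^ ringIndex s y) ^ p := by
            refine Real.rpow_le_rpow (norm_nonneg _) ((norm_sub_le _ _).trans ?_) hp0.le
            exact add_le_add (norm_lt_of_ringIndex hs x).le (norm_lt_of_ringIndex hs y).le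
        _ ≤ _ := real_rpow_add_le_mul_rpow_add_rpow (by positivity) (by positivity) hp)
    K μ (empiricalMeasure x) (by simp)
  refine le_trans ?_ h3
  calc wasserstein (maxNorm d) p μ (empiricalMeasure x) ^ p
      ≤ ((∫⁻ z, ENNReal.ofReal (maxNorm d (z.1 - z.2) ^ p) ∂ξ) ^ (1 / p)) ^ p := by
        refine ENNReal.rpow_le_rpow ?_ hp0.le
        exact iInf₂_le ξ ⟨h1, h2⟩
    _ = _ := by
        rw [← ENNReal.rpow_mul, one_div, inv_mul_cancel₀ hp0.ne', ENNReal.rpow_one]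

/-- The finest-level term is `2 ^ (-p K)` times a sum that is finite because `p < q`, so it
disappears as `K` tends to infinity; the other bounds do not depend on `K`. -/
theorem lintegral_wasserstein_rpow_le {s p q : ℝ} (hd : 2 ≤ d) (hN : N ≠ 0) (hs : 0 < s)
    (hp : 1 ≤ p) (hpd : p < (d : ℝ) / 2) (hpq : p < q)
    (hM : absMoment (maxNorm d) q μ ≤ ENNReal.ofReal (s ^ q)) :
    ∫⁻ x : Fin N → Fin d → ℝ, wasserstein (maxNorm d) p μ (empiricalMeasure x) ^ p
      ∂(Measure.pi fun _ => μ) ≤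
      ∑' n, ENNReal.ofReal ((s * 2 ^ (n + 1)) ^ p * cubeConst d p * (N : ℝ) ^ (-(p / d)) *
        μ.real (ringIndex s ⁻¹' {n}) ^ (1 - p / d)) +
      ∑' n, ENNReal.ofReal (2 ^ (p - 1) * (s * 2 ^ n) ^ p) *
        ∫⁻ x : Fin N → Fin d → ℝ,
          ((μ (ringIndex s ⁻¹' {n}) - empiricalMeasure x (ringIndex s ⁻¹' {n})) +
          (empiricalMeasure x (ringIndex s ⁻¹' {n}) - μ (ringIndex s ⁻¹' {n})))
          ∂(Measure.pi fun _ => μ) := by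
  have hp0 : 0 < p := by linarith
  set S0 := ∑' n, ENNReal.ofReal ((s * 2 ^ (n + 1)) ^ p) * μ (ringIndex s ⁻¹' {n}) with hS0
  have hS0fin : S0 ≠ ∞ := by
    have : S0 ≤ ∑' n : ℕ, ENNReal.ofReal (s ^ p * 2 ^ p * 2 ^ q * ((2 : ℝ) ^ n) ^ (-(q - p))) := by
      refine ENNReal.tsum_le_tsum fun n => ?_
      rw [← ofReal_measureReal (μ := μ), ← ENNReal.ofReal_mul (by positivity)]
      refine ENNReal.ofReal_le_ofReal ?_
      refine (mul_le_mul_of_nonneg_left (measure_ring_le hs (hp0.trans hpq) μ hM n)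
        (by positivity)).trans (le_of_eq ?_)
      rw [Real.mul_rpow hs.le (by positivity), pow_succ, Real.mul_rpow (by positivity) zero_le_two,
        show -(q - p) = p + -q by ring, Real.rpow_add (by positivity)]
      ring
    refine ne_top_of_le_ne_top ?_ this
    rw [tsum_ofReal_dyadic (by linarith) (by positivity)]
    exact ENNReal.ofReal_ne_top
  have mring : ∀ n, Measurable fun x : Fin N → Fin d → ℝ =>
      empiricalMeasure x (ringIndex s ⁻¹' {n}) := fun n =>
    measurable_empiricalMeasure_apply (measurable_ringIndex s (measurableSet_singleton _))
  have mE := fun k n => measurable_cellExcess_empiricalMeasure (N := N) μ s k n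
  set R := ∑' n, ENNReal.ofReal ((s * 2 ^ (n + 1)) ^ p * cubeConst d p * (N : ℝ) ^ (-(p / d)) *
        μ.real (ringIndex s ⁻¹' {n}) ^ (1 - p / d)) with hR
  set T := ∑' n, ENNReal.ofReal (2 ^ (p - 1) * (s * 2 ^ n) ^ p) *
        ∫⁻ x : Fin N → Fin d → ℝ,
          ((μ (ringIndex s ⁻¹' {n}) - empiricalMeasure x (ringIndex s ⁻¹' {n})) +
          (empiricalMeasure x (ringIndex s ⁻¹' {n}) - μ (ringIndex s ⁻¹' {n})))
          ∂(Measure.pi fun _ => μ) with hT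
  have bound : ∀ K : ℕ, ∫⁻ x : Fin N → Fin d → ℝ,
      wasserstein (maxNorm d) p μ (empiricalMeasure x) ^ p ∂(Measure.pi fun _ => μ) ≤
      ENNReal.ofReal (((2 : ℝ) ^ (-p)) ^ K) * S0 + (R + T) := by
    intro K
    refine (lintegral_mono fun x => wasserstein_rpow_le μ hN hs hp K x).trans ?_
    have m1 : ∀ k n, Measurable fun x : Fin N → Fin d → ℝ => cellCost s p k n *
        cellExcess (ringIndex s) (cellIndex s) μ (empiricalMeasure x) (k + 1) n := fun k n =>
      (mE (k + 1) n).const_mul _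
    have m2 : ∀ n, Measurable fun x : Fin N → Fin d → ℝ =>
        ((μ (ringIndex s ⁻¹' {n}) - empiricalMeasure x (ringIndex s ⁻¹' {n})) +
          (empiricalMeasure x (ringIndex s ⁻¹' {n}) - μ (ringIndex s ⁻¹' {n}))) := fun n =>
      (measurable_const.sub (mring n)).add ((mring n).sub measurable_const)
    rw [lintegral_add_right _ (Measurable.tsum fun n => (m2 n).const_mul _),
      lintegral_add_left measurable_const, lintegral_const, measure_univ, mul_one, add_assoc]
    refine add_le_add (le_of_eq ?_) (add_le_add ?_ (le_of_eq ?_))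
    · rw [hS0, ← ENNReal.tsum_mul_left]
      refine tsum_congr fun n => ?_
      rw [cellCost_eq hs, two_pow_rpow_eq, mul_assoc]
    · rw [lintegral_finsetSum _ fun k _ => Measurable.tsum fun n => m1 k n]
      simp_rw [lintegral_tsum fun n => (m1 _ n).aemeasurable]
      rw [← Summable.tsum_finsetSum fun k _ => ENNReal.summable]
      refine ENNReal.tsum_le_tsum fun n => ?_
      simp_rw [lintegral_const_mul _ (mE _ n)]
      exact sum_cellCost_mul_lintegral_cellExcess_le μ hd hN hs hp0 hpd K n
    · rw [lintegral_tsum fun n => ((m2 n).const_mul _).aemeasurable]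
      refine tsum_congr fun n => ?_
      rw [lintegral_const_mul _ (m2 n)]
  have hlim : Filter.Tendsto (fun K : ℕ => ENNReal.ofReal (((2 : ℝ) ^ (-p)) ^ K) * S0 + (R + T))
      Filter.atTop (nhds (0 * S0 + (R + T))) := by
    refine Filter.Tendsto.add_const _ (ENNReal.Tendsto.mul_const ?_ (Or.inr hS0fin))
    rw [← ENNReal.ofReal_zero]
    refine ENNReal.tendsto_ofReal (tendsto_pow_atTop_nhds_zero_of_lt_one (by positivity) ?_)
    exact Real.rpow_lt_one_of_one_lt_of_neg one_lt_two (by linarith)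
  have := ge_of_tendsto' hlim bound
  rwa [zero_mul, zero_add] at this

end ExpectedCost

/-! ### Summation over the rings and choice of scale. -/

section PierceConstants

variable {d N : ℕ} (μ : Measure (Fin d → ℝ))

/-- The scale decreases to the moment norm instead of being equal to it, since that norm may vanish
while `s` must be positive; an infinite moment leaves nothing to check. -/
theorem randError_le_of_forall_scale {p q C : ℝ} (hp : 0 < p) (hq : 0 < q) (hC : 0 < C)
    (hN : N ≠ 0)
    (h : ∀ s : ℝ, 0 < s → absMoment (maxNorm d) q μ ≤ ENNReal.ofReal (s ^ q) →
      ∫⁻ x : Fin N → Fin d → ℝ, wasserstein (maxNorm d) p μ (empiricalMeasure x) ^ p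
        ∂(Measure.pi fun _ => μ) ≤ ENNReal.ofReal (s ^ p * (N : ℝ) ^ (-(p / d)) * C)) :
    randError (maxNorm d) N p μ ≤ ENNReal.ofReal (C ^ (1 / p)) *
      absMoment (maxNorm d) q μ ^ (1 / q) * (N : ℝ≥0∞) ^ (-(1 / (d : ℝ))) := by
  have hNp : (0 : ℝ) < N := by exact_mod_cast Nat.pos_of_ne_zero hN
  have hNe : (N : ℝ≥0∞) ^ (-(1 / (d : ℝ))) = ENNReal.ofReal ((N : ℝ) ^ (-(1 / (d : ℝ)))) := by
    rw [← ENNReal.ofReal_rpow_of_pos hNp, ENNReal.ofReal_natCast]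
  set B : ℝ := C ^ (1 / p) * (N : ℝ) ^ (-(1 / (d : ℝ))) with hB
  have hBp : 0 < B := by positivity
  have hBe : ENNReal.ofReal (C ^ (1 / p)) * absMoment (maxNorm d) q μ ^ (1 / q) *
      (N : ℝ≥0∞) ^ (-(1 / (d : ℝ))) = ENNReal.ofReal B * absMoment (maxNorm d) q μ ^ (1 / q) := by
    rw [hNe, hB, ENNReal.ofReal_mul (by positivity)]
    ring
  rw [hBe]
  have hB0 : ENNReal.ofReal B ≠ 0 := by simpa using hBp
  rw [mul_comm, ← ENNReal.div_le_iff hB0 ENNReal.ofReal_ne_top]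
  refine le_of_forall_gt_imp_ge_of_dense fun a ha => ?_
  rcases eq_or_ne a ∞ with rfl | hat
  · exact le_top
  lift a to NNReal using hat
  have ha0 : 0 < (a : ℝ) := by
    have : (0 : ℝ≥0∞) < a := lt_of_le_of_lt bot_le ha
    exact_mod_cast this
  rw [ENNReal.div_le_iff hB0 ENNReal.ofReal_ne_top, ← ENNReal.ofReal_coe_nnreal,
    ← ENNReal.ofReal_mul ha0.le, randError]
  have hM : absMoment (maxNorm d) q μ ≤ ENNReal.ofReal ((a : ℝ) ^ q) := by
    have := ENNReal.rpow_le_rpow ha.le hq.le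
    rwa [← ENNReal.rpow_mul, one_div, inv_mul_cancel₀ hq.ne', ENNReal.rpow_one,
      ← ENNReal.ofReal_coe_nnreal, ENNReal.ofReal_rpow_of_nonneg ha0.le hq.le] at this
  refine (ENNReal.rpow_le_rpow (h a ha0 hM) (by positivity)).trans (le_of_eq ?_)
  rw [ENNReal.ofReal_rpow_of_nonneg (by positivity) (by positivity),
    Real.mul_rpow (by positivity) hC.le, Real.mul_rpow (by positivity) (by positivity),
    ← Real.rpow_mul ha0.le, ← Real.rpow_mul hNp.le, mul_one_div_cancel hp.ne', Real.rpow_one, hB,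
    show -(p / (d : ℝ)) * (1 / p) = -(1 / (d : ℝ)) by field_simp]
  congr 1
  ring

variable [IsProbabilityMeasure μ]

theorem tsum_ring_cells_le {s p q : ℝ} (hs : 0 < s) (hpd : p < (d : ℝ) / 2) (hp : 0 < p)
    (hq : p < q * (1 - p / d)) (hΓ : 0 ≤ cubeConst d p)
    (hM : absMoment (maxNorm d) q μ ≤ ENNReal.ofReal (s ^ q)) :
    ∑' n, ENNReal.ofReal ((s * 2 ^ (n + 1)) ^ p * cubeConst d p * (N : ℝ) ^ (-(p / d)) *
        μ.real (ringIndex s ⁻¹' {n}) ^ (1 - p / d)) ≤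
      ENNReal.ofReal (s ^ p * (N : ℝ) ^ (-(p / d)) *
        (2 ^ (p + q * (1 - p / d)) * cubeConst d p / (1 - 2 ^ (-q * (1 - p / d) + p)))) := by
  have hd : (0 : ℝ) < d := by linarith
  have hpd1 : 0 < 1 - p / d := by
    rw [sub_pos, div_lt_one hd]
    linarith
  have hq0 : 0 < q := pos_of_mul_pos_left (hp.trans hq) hpd1.le
  have key := tsum_ofReal_dyadic (e := q * (1 - p / d) - p)
    (c := s ^ p * (N : ℝ) ^ (-(p / d)) * (2 ^ (p + q * (1 - p / d)) * cubeConst d p))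
    (by linarith) (by positivity)
  rw [← mul_div_assoc, show -q * (1 - p / d) + p = -(q * (1 - p / d) - p) by ring, ← key]
  refine ENNReal.tsum_le_tsum fun n => ENNReal.ofReal_le_ofReal ?_
  have h := Real.rpow_le_rpow measureReal_nonneg (measure_ring_le hs hq0 μ hM n) hpd1.le
  refine (mul_le_mul_of_nonneg_left h (by positivity)).trans (le_of_eq ?_)
  rw [Real.mul_rpow hs.le (by positivity), pow_succ, Real.mul_rpow (by positivity) zero_le_two,
    Real.mul_rpow (by positivity) (by positivity), ← Real.rpow_mul zero_le_two,
    ← Real.rpow_mul (by positivity), show -(q * (1 - p / d) - p) = p + -q * (1 - p / d) by ring,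
    Real.rpow_add (by positivity : (0 : ℝ) < 2 ^ n), Real.rpow_add two_pos]
  ring

theorem lintegral_ring_deviation_le (hN : N ≠ 0) {A : Set (Fin d → ℝ)} (hA : MeasurableSet A) :
    ∫⁻ x : Fin N → Fin d → ℝ, ((μ A - empiricalMeasure x A) + (empiricalMeasure x A - μ A))
        ∂(Measure.pi fun _ => μ) ≤ ENNReal.ofReal ((μ.real A / N) ^ (1 / 2 : ℝ)) ∧
    ∫⁻ x : Fin N → Fin d → ℝ, ((μ A - empiricalMeasure x A) + (empiricalMeasure x A - μ A))
        ∂(Measure.pi fun _ => μ) ≤ ENNReal.ofReal (2 * μ.real A) := by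
  have hm : Measurable fun x : Fin N → Fin d → ℝ => empiricalMeasure x A :=
    measurable_empiricalMeasure_apply hA
  have hm1 : Measurable fun x : Fin N → Fin d → ℝ => μ A - empiricalMeasure x A :=
    measurable_const.sub hm
  have hNp : (0 : ℝ) < N := by exact_mod_cast Nat.pos_of_ne_zero hN
  rw [lintegral_add_left hm1]
  constructor
  · obtain ⟨h1, h2⟩ := lintegral_tsub_empiricalMeasure_le μ hN hA
    refine (add_le_add h1 h2).trans (le_of_eq ?_)
    rw [← add_mul, ENNReal.inv_two_add_inv_two, one_mul,
      ← ENNReal.ofReal_rpow_of_nonneg (by positivity) (by positivity),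
      ENNReal.ofReal_div_of_pos hNp, ENNReal.ofReal_natCast, ofReal_measureReal]
  · rw [two_mul, ENNReal.ofReal_add measureReal_nonneg measureReal_nonneg, ofReal_measureReal]
    refine add_le_add ?_ ?_
    · refine (lintegral_mono fun x => tsub_le_self).trans ?_
      simp
    · refine (lintegral_mono fun x => tsub_le_self).trans ?_
      rw [lintegral_empiricalMeasure μ hN hA]

/-- For `m > 0` the three quantities are `m` times `(m M) ^ (-1/2)`, `2` and `2 (m M) ^ (-θ)`;
compare according to whether `m M ≥ 1`. -/
theorem min_sqrt_le_rpow {m M θ : ℝ} (hm : 0 ≤ m) (hM : 0 < M) (h0 : 0 ≤ θ) (h1 : θ < 1 / 2) :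
    min ((m / M) ^ (1 / 2 : ℝ)) (2 * m) ≤ 2 * (M ^ (-θ) * m ^ (1 - θ)) := by
  rcases hm.eq_or_lt with rfl | hm
  · refine (min_le_right _ _).trans ?_
    rw [mul_zero]
    positivity
  have e : M ^ (-θ) * m ^ (1 - θ) = m * (m * M) ^ (-θ) := by
    rw [Real.mul_rpow hm.le hM.le, sub_eq_add_neg, Real.rpow_add hm, Real.rpow_one]
    ring
  rw [e]
  rcases le_total 1 (m * M) with h | h
  · have e2 : (m / M) ^ (1 / 2 : ℝ) = m * (m * M) ^ (-(1 / 2) : ℝ) := by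
      rw [Real.div_rpow hm.le hM.le, Real.mul_rpow hm.le hM.le, ← mul_assoc, div_eq_mul_inv,
        ← Real.rpow_neg hM.le]
      nth_rewrite 2 [← Real.rpow_one m]
      rw [← Real.rpow_add hm]
      norm_num
    refine (min_le_left _ _).trans ?_
    have h3 : (m * M) ^ (-(1 / 2) : ℝ) ≤ (m * M) ^ (-θ) :=
      Real.rpow_le_rpow_of_exponent_le h (by linarith)
    rw [e2]
    have h4 : 0 ≤ (m * M) ^ (-θ) := by positivity
    nlinarith [mul_le_mul_of_nonneg_left h3 hm.le, mul_nonneg hm.le h4]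
  · refine (min_le_right _ _).trans ?_
    have h3 : 1 ≤ (m * M) ^ (-θ) :=
      Real.one_le_rpow_of_pos_of_le_one_of_nonpos (by positivity) h (by linarith)
    nlinarith

/-- Interpolation with `θ = p/d` gives the same decay in `n` as for the cells, so no condition `q >
2p` is needed. -/
theorem tsum_ring_deviation_le {s p q : ℝ} (hN : N ≠ 0) (hs : 0 < s) (hpd : p < (d : ℝ) / 2)
    (hp : 0 < p) (hq : p < q * (1 - p / d))
    (hM : absMoment (maxNorm d) q μ ≤ ENNReal.ofReal (s ^ q)) :
    ∑' n, ENNReal.ofReal (2 ^ (p - 1) * (s * 2 ^ n) ^ p) *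
        ∫⁻ x : Fin N → Fin d → ℝ,
          ((μ (ringIndex s ⁻¹' {n}) - empiricalMeasure x (ringIndex s ⁻¹' {n})) +
          (empiricalMeasure x (ringIndex s ⁻¹' {n}) - μ (ringIndex s ⁻¹' {n})))
          ∂(Measure.pi fun _ => μ) ≤
      ENNReal.ofReal (s ^ p * (N : ℝ) ^ (-(p / d)) *
        (2 ^ p * 2 ^ (q * (1 - p / d)) / (1 - 2 ^ (-(q * (1 - p / d) - p))))) := by
  have hd : (0 : ℝ) < d := by linarith
  have hNp : (0 : ℝ) < N := by exact_mod_cast Nat.pos_of_ne_zero hN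
  have hpd1 : p / d < 1 / 2 := by
    rw [div_lt_iff₀ hd]
    linarith
  have hpd2 : 0 < 1 - p / d := by linarith
  have hq0 : 0 < q := pos_of_mul_pos_left (hp.trans hq) hpd2.le
  have key := tsum_ofReal_dyadic (e := q * (1 - p / d) - p)
    (c := s ^ p * (N : ℝ) ^ (-(p / d)) * (2 ^ p * 2 ^ (q * (1 - p / d))))
    (by linarith) (by positivity)
  rw [← mul_div_assoc, ← key]
  refine ENNReal.tsum_le_tsum fun n => ?_
  have hA : MeasurableSet (ringIndex s ⁻¹' {n} : Set (Fin d → ℝ)) :=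
    measurable_ringIndex s (measurableSet_singleton _)
  obtain ⟨h1, h2⟩ := lintegral_ring_deviation_le (N := N) μ hN hA
  have h3 := le_min h1 h2
  rw [← ENNReal.ofReal_min] at h3
  refine (mul_le_mul_right h3 _).trans ?_
  rw [← ENNReal.ofReal_mul (by positivity)]
  refine ENNReal.ofReal_le_ofReal ?_
  have h4 := min_sqrt_le_rpow (measureReal_nonneg : 0 ≤ μ.real (ringIndex s ⁻¹' {n})) hNp
    (by positivity) hpd1
  have h5 := Real.rpow_le_rpow measureReal_nonneg (measure_ring_le hs hq0 μ hM n) hpd2.le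
  calc _ ≤ 2 ^ (p - 1) * (s * 2 ^ n) ^ p *
        (2 * ((N : ℝ) ^ (-(p / d)) * (2 ^ q * ((2 : ℝ) ^ n) ^ (-q)) ^ (1 - p / d))) := by
        refine mul_le_mul_of_nonneg_left (h4.trans ?_) (by positivity)
        gcongr
    _ = _ := by
        rw [Real.mul_rpow hs.le (by positivity), Real.mul_rpow (by positivity) (by positivity),
          ← Real.rpow_mul zero_le_two, ← Real.rpow_mul (by positivity),
          show -(q * (1 - p / d) - p) = p + -q * (1 - p / d) by ring,
          Real.rpow_add (by positivity : (0 : ℝ) < 2 ^ n), Real.rpow_sub two_pos, Real.rpow_one]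
        ring

/-- The square root of the ring mass decays like `2 ^ (-n q/2)`, which beats `2 ^ (n p)` when `q >
2p`; moreover `N ^ (-1/2) ≤ N ^ (-p/d)`. -/
theorem tsum_ring_deviation_le_of_two_mul_lt {s p q : ℝ} (hN : N ≠ 0) (hs : 0 < s)
    (hpd : p < (d : ℝ) / 2) (hp : 0 < p) (hq : 2 * p < q)
    (hM : absMoment (maxNorm d) q μ ≤ ENNReal.ofReal (s ^ q)) :
    ∑' n, ENNReal.ofReal (2 ^ (p - 1) * (s * 2 ^ n) ^ p) *
        ∫⁻ x : Fin N → Fin d → ℝ,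
          ((μ (ringIndex s ⁻¹' {n}) - empiricalMeasure x (ringIndex s ⁻¹' {n})) +
          (empiricalMeasure x (ringIndex s ⁻¹' {n}) - μ (ringIndex s ⁻¹' {n})))
          ∂(Measure.pi fun _ => μ) ≤
      ENNReal.ofReal (s ^ p * (N : ℝ) ^ (-(p / d)) *
        (2 ^ (p - 1) * 2 ^ (q / 2) / (1 - 2 ^ (p - q / 2)))) := by
  have hd : (0 : ℝ) < d := by linarith
  have hNp : (0 : ℝ) < N := by exact_mod_cast Nat.pos_of_ne_zero hN
  have hN1 : (1 : ℝ) ≤ N := by exact_mod_cast Nat.pos_of_ne_zero hN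
  have hpd1 : p / d < 1 / 2 := by
    rw [div_lt_iff₀ hd]
    linarith
  have key := tsum_ofReal_dyadic (e := q / 2 - p)
    (c := s ^ p * (N : ℝ) ^ (-(p / d)) * (2 ^ (p - 1) * 2 ^ (q / 2)))
    (by linarith) (by positivity)
  rw [← mul_div_assoc, ← neg_sub (q / 2), ← key]
  refine ENNReal.tsum_le_tsum fun n => ?_
  have hA : MeasurableSet (ringIndex s ⁻¹' {n} : Set (Fin d → ℝ)) :=
    measurable_ringIndex s (measurableSet_singleton _)
  refine (mul_le_mul_right (lintegral_ring_deviation_le (N := N) μ hN hA).1 _).trans ?_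
  rw [← ENNReal.ofReal_mul (by positivity)]
  refine ENNReal.ofReal_le_ofReal ?_
  have h5 := Real.rpow_le_rpow measureReal_nonneg (measure_ring_le hs (by linarith) μ hM n)
    (by norm_num : (0 : ℝ) ≤ 1 / 2)
  have h6 : (N : ℝ) ^ (-(1 / 2) : ℝ) ≤ (N : ℝ) ^ (-(p / d)) :=
    Real.rpow_le_rpow_of_exponent_le hN1 (by linarith)
  calc _ = 2 ^ (p - 1) * (s * 2 ^ n) ^ p *
        (μ.real (ringIndex s ⁻¹' {n}) ^ (1 / 2 : ℝ) * (N : ℝ) ^ (-(1 / 2) : ℝ)) := by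
        rw [Real.div_rpow measureReal_nonneg hNp.le, Real.rpow_neg hNp.le, div_eq_mul_inv]
    _ ≤ 2 ^ (p - 1) * (s * 2 ^ n) ^ p *
        ((2 ^ q * ((2 : ℝ) ^ n) ^ (-q)) ^ (1 / 2 : ℝ) * (N : ℝ) ^ (-(p / d))) := by
        gcongr
    _ = _ := by
        rw [Real.mul_rpow hs.le (by positivity), Real.mul_rpow (by positivity) (by positivity),
          ← Real.rpow_mul zero_le_two, ← Real.rpow_mul (by positivity),
          show -(q / 2 - p) = p + -q * (1 / 2) by ring,
          Real.rpow_add (by positivity : (0 : ℝ) < 2 ^ n), show q * (1 / 2) = q / 2 by ring]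
        ring

/-- The ring imbalance enters as a hypothesis, so that both ways of estimating it share this step.
-/
theorem randError_maxNorm_le_of_ring_deviation {p q A : ℝ} (hd : 2 ≤ d) (hN : N ≠ 0) (hp : 1 ≤ p)
    (hpd : p < (d : ℝ) / 2) (hq : p < q * (1 - p / d)) (hA : 0 ≤ A)
    (h : ∀ s : ℝ, 0 < s → absMoment (maxNorm d) q μ ≤ ENNReal.ofReal (s ^ q) →
      ∑' n, ENNReal.ofReal (2 ^ (p - 1) * (s * 2 ^ n) ^ p) *
        ∫⁻ x : Fin N → Fin d → ℝ,
          ((μ (ringIndex s ⁻¹' {n}) - empiricalMeasure x (ringIndex s ⁻¹' {n})) +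
          (empiricalMeasure x (ringIndex s ⁻¹' {n}) - μ (ringIndex s ⁻¹' {n})))
          ∂(Measure.pi fun _ => μ) ≤ ENNReal.ofReal (s ^ p * (N : ℝ) ^ (-(p / d)) * A)) :
    randError (maxNorm d) N p μ ≤ ENNReal.ofReal ((A + 2 ^ (p + q * (1 - p / d)) * cubeConst d p /
        (1 - 2 ^ (-q * (1 - p / d) + p))) ^ (1 / p)) *
      absMoment (maxNorm d) q μ ^ (1 / q) * (N : ℝ≥0∞) ^ (-(1 / (d : ℝ))) := by
  have hp0 : 0 < p := by linarith
  have hd0 : (0 : ℝ) < d := by linarith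
  have hpd1 : p / d < 1 := by
    rw [div_lt_one hd0]
    linarith
  have hpd0 : 0 < p / d := by positivity
  have hq0 : 0 < q := pos_of_mul_pos_left (hp0.trans hq) (by linarith)
  have hpq : p < q := by nlinarith
  have hΓ := one_le_cubeConst hd hp0 hpd
  have hden : 0 < 1 - (2 : ℝ) ^ (-q * (1 - p / d) + p) := by
    rw [sub_pos]
    exact Real.rpow_lt_one_of_one_lt_of_neg one_lt_two (by linarith)
  have hΓ0 : 0 < cubeConst d p := by linarith
  refine randError_le_of_forall_scale μ hp0 hq0 (by positivity) hN fun s hs hM => ?_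
  refine (lintegral_wasserstein_rpow_le μ hd hN hs hp hpd hpq hM).trans ?_
  refine (add_le_add (tsum_ring_cells_le μ hs hpd hp0 hq hΓ0.le hM) (h s hs hM)).trans
    (le_of_eq ?_)
  rw [← ENNReal.ofReal_add (by positivity) (by positivity)]
  congr 1
  ring

end PierceConstants

/-! ### Comparison with the stated cube constant. -/

section CubeConstants

variable {d : ℕ}

theorem one_le_cubeDiam_maxNorm (hd : 0 < d) : 1 ≤ cubeDiam (maxNorm d) := by
  refine le_of_forall_lt fun c hc => ?_
  -- The cube is half-open, so distance one is only approached, by the diagonal points `(e, …, e)`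
  -- and the origin.
  obtain ⟨e, he, he1⟩ := exists_between (max_lt hc zero_lt_one)
  have he0 : 0 ≤ e := (le_max_right c 0).trans he.le
  refine ((le_max_left c 0).trans_lt he).trans_le (le_csSup ?_ ?_)
  · refine ⟨1, ?_⟩
    rintro r ⟨x, y, hx, hy, rfl⟩
    refine (pi_norm_le_iff_of_nonneg zero_le_one).2 fun i => ?_
    rw [Pi.sub_apply, Real.norm_eq_abs, abs_le]
    obtain ⟨h1, h2⟩ := hx i
    obtain ⟨h3, h4⟩ := hy i
    constructor <;> linarith
  · refine ⟨fun _ => e, fun _ => 0, fun _ => ⟨he0, he1⟩, fun _ => ⟨le_rfl, zero_lt_one⟩, ?_⟩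
    have : Nonempty (Fin d) := ⟨⟨0, hd⟩⟩
    change e = ‖(fun _ : Fin d => e) - fun _ => (0 : ℝ)‖
    have e1 : ((fun _ : Fin d => e) - fun _ => (0 : ℝ)) = fun _ => e := by
      ext
      simp
    rw [e1, pi_norm_const, Real.norm_of_nonneg he0]

theorem cubeConst_le_kappaCube_rpow {p : ℝ} (hd : 2 ≤ d) (hp : 0 < p) (hpd : p < (d : ℝ) / 2) :
    0 < kappaCube (maxNorm d) p ∧ cubeConst d p ≤ kappaCube (maxNorm d) p ^ p := by
  have hΓ := one_le_cubeConst hd hp hpd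
  have hD := one_le_cubeDiam_maxNorm (d := d) (by omega)
  have hD0 : 0 < cubeDiam (maxNorm d) := by linarith
  have hbr : 0 < 1 / (1 - (2 : ℝ) ^ (p - (d : ℝ) / 2)) + 1 / (1 - (2 : ℝ) ^ (-p)) :=
    (mul_pos_iff_of_pos_left (by positivity : 0 < (2 : ℝ) ^ ((d : ℝ) / 2 - 1))).1
      (zero_lt_one.trans_le hΓ)
  constructor
  · rw [kappaCube]
    positivity
  · have e : kappaCube (maxNorm d) p ^ p = cubeDiam (maxNorm d) ^ p * cubeConst d p := by
      rw [kappaCube, Real.mul_rpow (by positivity) (by positivity),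
        Real.mul_rpow (by positivity) (by positivity), ← Real.rpow_mul zero_le_two,
        ← Real.rpow_mul hbr.le, one_div_mul_cancel hp.ne', Real.rpow_one, cubeConst,
        show ((d : ℝ) - 2) / (2 * p) * p = (d : ℝ) / 2 - 1 by field_simp, mul_assoc]
    rw [e]
    exact le_mul_of_one_le_left (by linarith) (Real.one_le_rpow hD hp.le)

end CubeConstants

/-! ### Passage to an arbitrary norm. -/

section NormComparison

variable {d : ℕ}

/-- The upper bound comes from expansion in the standard basis, which also gives continuity; the
lower one from a minimum on the compact unit sphere. -/
theorem Seminorm.exists_norm_equiv (nrm : Seminorm ℝ (Fin d → ℝ)) (h0 : ∀ x, nrm x = 0 → x = 0) :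
    ∃ c₁ c₂ : ℝ, 0 < c₁ ∧ 0 < c₂ ∧ ∀ x, nrm x ≤ c₁ * ‖x‖ ∧ ‖x‖ ≤ c₂ * nrm x := by
  have upper : ∀ x, nrm x ≤ (∑ i, nrm (Pi.single i 1) + 1) * ‖x‖ := by
    intro x
    have hx : x = ∑ i, x i • (Pi.single i (1 : ℝ) : Fin d → ℝ) := by
      simpa using pi_eq_sum_univ' x
    calc nrm x = nrm (∑ i, x i • (Pi.single i (1 : ℝ) : Fin d → ℝ)) := by rw [← hx]
      _ ≤ ∑ i, nrm (x i • (Pi.single i (1 : ℝ) : Fin d → ℝ)) := by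
        exact Finset.le_sum_of_subadditive nrm (map_zero nrm).le (map_add_le_add nrm) _ _
      _ ≤ ∑ i, ‖x‖ * nrm (Pi.single i 1) := by
        refine Finset.sum_le_sum fun i _ => ?_
        rw [map_smul_eq_mul]
        exact mul_le_mul_of_nonneg_right (norm_le_pi_norm x i) (apply_nonneg _ _)
      _ ≤ _ := by
        rw [← Finset.mul_sum]
        nlinarith [norm_nonneg x]
  have hc₁ : 0 < ∑ i, nrm (Pi.single i (1 : ℝ)) + 1 := by
    have : 0 ≤ ∑ i, nrm (Pi.single i (1 : ℝ)) := Finset.sum_nonneg fun i _ => apply_nonneg _ _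
    linarith
  have hcont : Continuous nrm := by
    obtain ⟨C, hC⟩ : ∃ C : NNReal, (C : ℝ) = ∑ i, nrm (Pi.single i (1 : ℝ)) + 1 :=
      ⟨⟨_, hc₁.le⟩, rfl⟩
    have hq : Continuous (C • normSeminorm ℝ (Fin d → ℝ)) := continuous_norm.const_smul C
    refine Seminorm.continuous_of_le hq fun x => (upper x).trans (le_of_eq ?_)
    rw [← hC]
    rfl
  obtain ⟨c, hc, hcs⟩ : ∃ c : ℝ, 0 < c ∧ ∀ x ∈ Metric.sphere (0 : Fin d → ℝ) 1, c ≤ nrm x := by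
    rcases (Metric.sphere (0 : Fin d → ℝ) 1).eq_empty_or_nonempty with he | hne
    · exact ⟨1, one_pos, by simp [he]⟩
    · obtain ⟨x₀, hx₀, hmin⟩ := (isCompact_sphere (0 : Fin d → ℝ) 1).exists_isMinOn hne
        hcont.continuousOn
      refine ⟨nrm x₀, lt_of_le_of_ne (apply_nonneg _ _) fun h => ?_, fun x hx => hmin hx⟩
      have := h0 x₀ h.symm
      rw [mem_sphere_zero_iff_norm, this, norm_zero] at hx₀
      exact zero_ne_one hx₀
  refine ⟨_, c⁻¹, hc₁, inv_pos.2 hc, fun x => ⟨upper x, ?_⟩⟩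
  rcases eq_or_ne x 0 with rfl | hx
  · simp
  · have hn : 0 < ‖x‖ := norm_pos_iff.2 hx
    have := hcs (‖x‖⁻¹ • x) (by
      rw [mem_sphere_zero_iff_norm, norm_smul, norm_inv, norm_norm, inv_mul_cancel₀ hn.ne'])
    rw [map_smul_eq_mul, norm_inv, norm_norm, inv_mul_eq_div, le_div_iff₀ hn] at this
    rw [inv_mul_eq_div, le_div_iff₀ hc]
    linarith

variable {nrm nrm' : Seminorm ℝ (Fin d → ℝ)} {c : ℝ}

theorem wasserstein_le_mul (hc : 0 < c) (h : ∀ x, nrm x ≤ c * nrm' x) {p : ℝ} (hp : 0 < p)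
    (μ ν : Measure (Fin d → ℝ)) :
    wasserstein nrm p μ ν ≤ ENNReal.ofReal c * wasserstein nrm' p μ ν := by
  have hc0 : ENNReal.ofReal c ≠ 0 := by simpa using hc
  rw [wasserstein, wasserstein, ENNReal.mul_iInf_of_ne hc0 ENNReal.ofReal_ne_top]
  refine iInf_mono fun ξ => ?_
  rw [ENNReal.mul_iInf_of_ne hc0 ENNReal.ofReal_ne_top]
  refine iInf_mono fun _ => ?_
  have e : ENNReal.ofReal c = (ENNReal.ofReal (c ^ p)) ^ (1 / p) := by
    rw [ENNReal.ofReal_rpow_of_nonneg (by positivity) (by positivity), ← Real.rpow_mul hc.le,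
      mul_one_div_cancel hp.ne', Real.rpow_one]
  rw [e, ← ENNReal.mul_rpow_of_nonneg _ _ (by positivity),
    ← lintegral_const_mul' _ _ ENNReal.ofReal_ne_top]
  refine ENNReal.rpow_le_rpow (lintegral_mono fun z => ?_) (by positivity)
  rw [← ENNReal.ofReal_mul (by positivity), ← Real.mul_rpow hc.le (apply_nonneg _ _)]
  exact ENNReal.ofReal_le_ofReal (Real.rpow_le_rpow (apply_nonneg _ _) (h _) hp.le)

theorem randError_le_mul (hc : 0 < c) (h : ∀ x, nrm x ≤ c * nrm' x) {p : ℝ} (hp : 0 < p) (N : ℕ)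
    (μ : Measure (Fin d → ℝ)) : randError nrm N p μ ≤ ENNReal.ofReal c * randError nrm' N p μ := by
  have e : ENNReal.ofReal c = (ENNReal.ofReal c ^ p) ^ (1 / p) := by
    rw [← ENNReal.rpow_mul, mul_one_div_cancel hp.ne', ENNReal.rpow_one]
  rw [randError, randError, e, ← ENNReal.mul_rpow_of_nonneg _ _ (by positivity),
    ← lintegral_const_mul' _ _ (ENNReal.rpow_ne_top_of_nonneg hp.le ENNReal.ofReal_ne_top)]
  refine ENNReal.rpow_le_rpow (lintegral_mono fun x => ?_) (by positivity)
  rw [← ENNReal.mul_rpow_of_nonneg _ _ hp.le]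
  exact ENNReal.rpow_le_rpow (wasserstein_le_mul hc h hp _ _) hp.le

theorem absMoment_rpow_le_mul (hc : 0 < c) (h : ∀ x, nrm x ≤ c * nrm' x) {q : ℝ} (hq : 0 < q)
    (μ : Measure (Fin d → ℝ)) :
    absMoment nrm q μ ^ (1 / q) ≤ ENNReal.ofReal c * absMoment nrm' q μ ^ (1 / q) := by
  have e : ENNReal.ofReal c = (ENNReal.ofReal (c ^ q)) ^ (1 / q) := by
    rw [ENNReal.ofReal_rpow_of_nonneg (by positivity) (by positivity), ← Real.rpow_mul hc.le,
      mul_one_div_cancel hq.ne', Real.rpow_one]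
  rw [e, ← ENNReal.mul_rpow_of_nonneg _ _ (by positivity), absMoment, absMoment,
    ← lintegral_const_mul' _ _ ENNReal.ofReal_ne_top]
  refine ENNReal.rpow_le_rpow (lintegral_mono fun z => ?_) (by positivity)
  rw [← ENNReal.ofReal_mul (by positivity), ← Real.mul_rpow hc.le (apply_nonneg _ _)]
  exact ENNReal.ofReal_le_ofReal (Real.rpow_le_rpow (apply_nonneg _ _) (h _) hq.le)

end NormComparison

/-! ### The two parts of the theorem. -/

theorem theorem1p2 (d : ℕ) (hd : 3 ≤ d) (p q : ℝ) (hp1 : 1 ≤ p) (hp2 : p < (d : ℝ) / 2)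
    (hq : (d : ℝ) * p / ((d : ℝ) - p) < q) :
    (∀ nrm : Seminorm ℝ (Fin d → ℝ), (∀ x, nrm x = 0 → x = 0) →
      ∃ κ : ℝ, 0 < κ ∧ ∀ (μ : Measure (Fin d → ℝ)), IsProbabilityMeasure μ → ∀ N : ℕ, 1 ≤ N →
        randError nrm N p μ ≤
          ENNReal.ofReal κ * absMoment nrm q μ ^ (1 / q) * (N : ℝ≥0∞) ^ (-(1 / (d : ℝ)))) ∧
    (2 * p < q →
      ∀ (μ : Measure (Fin d → ℝ)), IsProbabilityMeasure μ → ∀ N : ℕ, 1 ≤ N →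
        randError (maxNorm d) N p μ ≤
          ENNReal.ofReal (kappaPierce (maxNorm d) p q) * absMoment (maxNorm d) q μ ^ (1 / q) *
            (N : ℝ≥0∞) ^ (-(1 / (d : ℝ)))) := by
  have hd2 : 2 ≤ d := by omega
  have hp0 : 0 < p := by linarith
  have hd0 : (0 : ℝ) < d := by linarith
  have hdp : 0 < (d : ℝ) - p := by linarith
  have hq' : p < q * (1 - p / d) := by
    rw [div_lt_iff₀ hdp] at hq
    rw [one_sub_div hd0.ne', ← mul_div_assoc, lt_div_iff₀ hd0]
    linarith
  have hpd1 : 0 < 1 - p / d := by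
    rw [one_sub_div hd0.ne']
    positivity
  have hq0 : 0 < q := pos_of_mul_pos_left (hp0.trans hq') hpd1.le
  have hΓ : 0 < cubeConst d p := by
    have := one_le_cubeConst hd2 hp0 hp2
    linarith
  have hden : 0 < 1 - (2 : ℝ) ^ (-q * (1 - p / d) + p) := by
    rw [sub_pos]
    exact Real.rpow_lt_one_of_one_lt_of_neg one_lt_two (by linarith)
  constructor
  · intro nrm h0
    obtain ⟨c₁, c₂, hc₁, hc₂, hc⟩ := nrm.exists_norm_equiv h0
    set A : ℝ := 2 ^ p * 2 ^ (q * (1 - p / d)) / (1 - 2 ^ (-(q * (1 - p / d) - p))) with hA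
    have hA0 : 0 ≤ A := by
      have : 0 < 1 - (2 : ℝ) ^ (-(q * (1 - p / d) - p)) := by
        rw [sub_pos]
        exact Real.rpow_lt_one_of_one_lt_of_neg one_lt_two (by linarith)
      positivity
    set κ : ℝ := (A + 2 ^ (p + q * (1 - p / d)) * cubeConst d p /
      (1 - 2 ^ (-q * (1 - p / d) + p))) ^ (1 / p) with hκ
    have hκ0 : 0 < κ := by positivity
    refine ⟨c₁ * κ * c₂, by positivity, fun μ _ N hN => ?_⟩
    have hmain := randError_maxNorm_le_of_ring_deviation (N := N) μ hd2 (by omega) hp1 hp2 hq' hA0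
      fun s hs hM => tsum_ring_deviation_le μ (by omega) hs hp2 hp0 hq' hM
    calc randError nrm N p μ ≤ ENNReal.ofReal c₁ * randError (maxNorm d) N p μ :=
          randError_le_mul hc₁ (fun x => (hc x).1) hp0 N μ
      _ ≤ ENNReal.ofReal c₁ * (ENNReal.ofReal κ *
          (ENNReal.ofReal c₂ * absMoment nrm q μ ^ (1 / q)) * (N : ℝ≥0∞) ^ (-(1 / (d : ℝ)))) := by
          refine mul_le_mul_right (hmain.trans ?_) _
          gcongr
          exact absMoment_rpow_le_mul hc₂ (fun x => (hc x).2) hq0 μ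
      _ = _ := by
          rw [ENNReal.ofReal_mul (by positivity), ENNReal.ofReal_mul hc₁.le]
          ring
  · intro hpq μ _ N hN
    have hden2 : 0 < 1 - (2 : ℝ) ^ (p - q / 2) := by
      rw [sub_pos]
      exact Real.rpow_lt_one_of_one_lt_of_neg one_lt_two (by linarith)
    refine (randError_maxNorm_le_of_ring_deviation (N := N) μ hd2 (by omega) hp1 hp2 hq'
      (by positivity) fun s hs hM =>
        tsum_ring_deviation_le_of_two_mul_lt μ (by omega) hs hp2 hp0 hpq hM).trans ?_
    gcongr
    obtain ⟨hk0, hk⟩ := cubeConst_le_kappaCube_rpow hd2 hp0 hp2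
    have hk1 : 1 ≤ kappaCube (maxNorm d) p := by
      by_contra! hlt
      have := Real.rpow_lt_one hk0.le hlt hp0
      linarith [one_le_cubeConst hd2 hp0 hp2]
    have hD : 1 ≤ cubeDiam (maxNorm d) ^ p :=
      Real.one_le_rpow (one_le_cubeDiam_maxNorm (by omega)) hp0.le
    rw [kappaPierce]
    -- The constant obtained is no larger than the stated one, which carries an additional factor
    -- `kappaCube ≥ 1`, a factor `cubeDiam ^ p ≥ 1`, and `kappaCube ^ p` in place of `cubeConst`.
    refine le_trans ?_ (le_mul_of_one_le_left (by positivity) hk1)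
    gcongr ((?_ : ℝ) / _ + _ * ?_ / _) ^ _
    exact le_mul_of_one_le_right (by positivity) hD
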